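/- **Algebras.** Let $G$ be a finite group, $K\subseteq G$ a subgroup and $R\ni e$ a transversal, so that every element of $G$ is uniquely $rx$ with $r\in R$, $x\in K$. Let $K$ act on $R$ by $x\triangleright r=$ the representative in $R$ of $xrK$. Put $\Xi(R,K)=\mathbb C(R)\rtimes\mathbb CK$ with $x\delta_r=\delta_{x\triangleright r}x$, and $D(G)=\mathbb C(G)\rtimes\mathbb CG$ with $h\delta_g=\delta_{hgh^{-1}}h$ and antipode $S(\delta_g h)=\delta_{h^{-1}g^{-1}h}h^{-1}$. There is an inclusion of algebras $i:\Xi(R,K)\to D(G)$, $i(x)=x$, $i(\delta_r)=\sum_{x\in K}\delta_{rx}$. Irreps of $\Xi(R,K)$ are $V_{\mathcal O,\rho}=\mathbb C\mathcal O\otimes V_\rho$, where $\mathcal O\subseteq R$ is a $K$-orbit with base point $r_0$ and $\rho$ is an irrep of the isotropy group $K^{r_0}$; given lifts $\kappa_r\in K$ with $\kappa_r\triangleright r_0=r$, $\kappa_{r_0}=e$, the action is $\delta_r(s\otimes v)=\delta_{r,s}\,s\otimes v$, $x(s\otimes v)=x\triangleright s\otimes\rho(\kappa_{x\triangleright s}^{-1}x\kappa_s)v$.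 The associated central projector is $$P_{(\mathcal O,\rho)}=\frac{\dim V_\rho}{|K^{r_0}|}\sum_{r\in\mathcal O}\sum_{n\in K^{r_0}}\mathrm{Tr}_\rho(n^{-1})\,\delta_r\otimes\kappa_rn\kappa_r^{-1}.$$ Irreps $W_{\mathcal C,\pi}$ of $D(G)$ and their projectors $P_{(\mathcal C,\pi)}$ are given in the same way by a conjugacy class $\mathcal C$ with base point $c_0$, an irrep $\pi$ of the centralizer $G^{c_0}$ and lifts $q_c$ with $q_cc_0q_c^{-1}=c$, $q_{c_0}=e$. Let $n^{(\mathcal O,\rho)}_{(\mathcal C,\pi)}=\dim\mathrm{Hom}_{\Xi}(V_{\mathcal O,\rho},i^*W_{\mathcal C,\pi})$, and let $P_{i^*(\mathcal C,\pi)}$ be the sum of the $P_{(\mathcal O,\rho)}$ over the isomorphism types of irreps of $\Xi(R,K)$ with $n^{(\mathcal O,\rho)}_{(\mathcal C,\pi)}\neq0$. Let $(\mathcal C^*,\pi^*)$ be the class of $c_0^{-1}$ with $q_{c^{-1}}=q_c$ and the dual $\pi^*$ of $\pi$. **Lattice.** Let $P$ be any set of unit faces of the square lattice $\mathbb Z^2$,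 for example a half-plane. The lattice consists of the arrows (oriented rightwards and upwards) on the border of faces in $P$; other arrows are undefined. States are functions $\psi$ of the assignments $\sigma$ of an element of $G$ to each arrow of the lattice, that is, elements of $\bigotimes_{\text{arrows}}\mathbb CG$ in the group basis (formal combinations if there are infinitely many arrows). At a vertex $v$, $h\triangleright_v$ sends the labels of outgoing arrows $g\mapsto hg$ and of incoming ones $g\mapsto gh^{-1}$. A vertex is in the bulk if its four faces lie in $P$. A site $(v,p)$ is a vertex $v$ with a face $p$ at $v$; it is in the bulk if $v$ is. At a bulk site $D(G)$ acts, $h$ by $h\triangleright_v$ and $\delta_g$ by the factor $\delta_g(\text{product of the labels clockwise around }p\text{ from }v)$, labels of arrows traversed backwards being inverted. A smooth-boundary site $s_0=(v,p)$ has $p\notin P$ and a boundary arrow of $p$ at $v$, that is, one with a face of $P$ on its other side. There $\Xi(R,K)$ acts by $\triangleright^b_{s_0}$: $x\in K$ by $x\triangleright_v$ (on the arrows present) and $\delta_r$ by the factor $\delta_{rK}(g)$, where $g$ is the label of the boundary arrow read starting from $v$. A vacuum state $|\mathrm{vac}\rangle$ is a nonzero state fixed by $\frac1{|G|}\sum_h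 h\triangleright_v$ at all bulk vertices, by $\delta_e\triangleright$ at all faces in $P$, and by $\frac1{|K|}\sum_{x\in K}x\triangleright^b$ and $\delta_e\triangleright^b$ at all smooth-boundary sites. **Ribbons.** A ribbon $\xi$ from $s_0$ to $s_1$ is a sequence of triangles between consecutive sites. A dual triangle fixes the vertex $v$ and rotates the face anticlockwise about $v$ across the next arrow at $v$; it has $F^{h,g}=\delta_{g,e}L^h$, with $L^h$ acting on that arrow as $h\triangleright_v$ does. A direct triangle fixes the face and moves the vertex clockwise around it along an arrow; it has $F^{h,g}=T^g$, the factor $\delta_g$ of the label read in the direction of motion. (We also allow mirror-image ribbons, with clockwise and anticlockwise exchanged throughout, in which case the product around the face in the $D(G)$-action at $s_1$ is taken anticlockwise.) The strip must not overlap itself: no triangle is repeated, and no arrow is both crossed by a dual triangle and traversed by a direct one. Ribbon operators are defined by $F^{h,g}_{\xi'\circ\xi}=\sum_{f\in G}F^{f^{-1}hf,f^{-1}g}_{\xi'}\circ F^{h,f}_\xi$, and $$W_\xi^{\mathcal C,\pi}=\sum_{c\in\mathcal C}\sum_i\sum_{n\in G^{c_0}}\pi(n^{-1})_{ii}\,F_\xi^{c,\,q_cnq_c^{-1}}.$$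 **Statement.** Let $s_0$ be a smooth-boundary site with algebra $\Xi(R,K)$, let $s_1$ be a bulk site, and let $\xi$ be a ribbon from $s_0$ to $s_1$ all of whose sites after $s_0$ have their faces in $P$, so that it starts by crossing the boundary arrow of $s_0$ and does not cross the boundary again. Let $|\mathrm{vac}\rangle$ be a vacuum state and $(\mathcal C,\pi)$ an irrep of $D(G)$. Then for every irrep $(\mathcal O,\rho)$ of $\Xi(R,K)$, $$P_{(\mathcal O,\rho)}\triangleright^b_{s_0}W_\xi^{\mathcal C,\pi}|\mathrm{vac}\rangle=0\iff n^{(\mathcal O,\rho)}_{(\mathcal C,\pi)}=0 .$$ Moreover $$P_{i^*(\mathcal C,\pi)}\triangleright^b_{s_0}W_\xi^{\mathcal C,\pi}|\mathrm{vac}\rangle=W_\xi^{\mathcal C,\pi}|\mathrm{vac}\rangle=W_\xi^{\mathcal C,\pi}|\mathrm{vac}\rangle\triangleleft_{s_1}P_{(\mathcal C,\pi)},$$ where $\psi\triangleleft_{s_1}d=S(d)\triangleright_{s_1}\psi$; and $P_{(\mathcal C^*,\pi^*)}\triangleright_{s_1}W_\xi^{\mathcal C,\pi}|\mathrm{vac}\rangle=W_\xi^{\mathcal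 C,\pi}|\mathrm{vac}\rangle$ as well. -/

import Mathlib

open scoped Classical

noncomputable section

namespace QDouble

/-! ## Crossed product algebras `ℂ(X) ⋊ ℂK` -/

/-- The crossed product `ℂ(X) ⋊ ℂK` for an action of `K` on a finite set `X`.  An element is given
by its coefficients `coeff x k` in the basis `δ_x ⊗ k`. -/
@[ext] structure Cross (X K : Type*) where
  coeff : X → K → ℂ

namespace Cross

section Linear

variable {X K : Type*}

instance : Zero (Cross X K) := ⟨⟨0⟩⟩
instance : Add (Cross X K) := ⟨fun a b => ⟨a.coeff + b.coeff⟩⟩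
instance : Neg (Cross X K) := ⟨fun a => ⟨-a.coeff⟩⟩
instance : Sub (Cross X K) := ⟨fun a b => ⟨a.coeff - b.coeff⟩⟩
instance : SMul ℕ (Cross X K) := ⟨fun z a => ⟨z • a.coeff⟩⟩
instance : SMul ℤ (Cross X K) := ⟨fun z a => ⟨z • a.coeff⟩⟩
instance : SMul ℂ (Cross X K) := ⟨fun z a => ⟨z • a.coeff⟩⟩

theorem coeff_injective : Function.Injective (Cross.coeff : Cross X K → X → K → ℂ) :=
  fun _ _ h => Cross.ext h

instance : AddCommGroup (Cross X K) :=
  coeff_injective.addCommGroup _ rfl (fun _ _ => rfl) (fun _ => rfl) (fun _ _ => rfl)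
    (fun _ _ => rfl) (fun _ _ => rfl)

/-- The coefficients as an additive map. -/
def coeffHom : Cross X K →+ (X → K → ℂ) := ⟨⟨Cross.coeff, rfl⟩, fun _ _ => rfl⟩

instance : Module ℂ (Cross X K) :=
  coeff_injective.module ℂ coeffHom (fun _ _ => rfl)

@[simp] theorem add_coeff (a b : Cross X K) (x : X) (k : K) :
    (a + b).coeff x k = a.coeff x k + b.coeff x k := rfl
@[simp] theorem zero_coeff (x : X) (k : K) : (0 : Cross X K).coeff x k = 0 := rfl
@[simp] theorem smul_coeff (z : ℂ) (a : Cross X K) (x : X) (k : K) :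
    (z • a).coeff x k = z * a.coeff x k := rfl

theorem sum_coeff {ι : Type*} (s : Finset ι) (f : ι → Cross X K) (x : X) (k : K) :
    (∑ i ∈ s, f i).coeff x k = ∑ i ∈ s, (f i).coeff x k := by
  show coeffHom (∑ i ∈ s, f i) x k = _
  rw [map_sum, Finset.sum_apply, Finset.sum_apply]
  rfl

/-- The basis element `δ_x ⊗ k`. -/
def basis (x : X) (k : K) : Cross X K := ⟨fun y l => if y = x ∧ l = k then 1 else 0⟩

theorem basis_coeff (x : X) (k : K) (y : X) (l : K) :
    (basis x k).coeff y l = if y = x ∧ l = k then 1 else 0 := rfl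

instance [One K] : One (Cross X K) := ⟨⟨fun _ k => if k = 1 then 1 else 0⟩⟩

theorem one_coeff [One K] (x : X) (k : K) :
    (1 : Cross X K).coeff x k = if k = 1 then 1 else 0 := rfl

end Linear

variable {X K : Type*} [Group K] [MulAction K X] [Fintype K]

/-- The product, determined by `(δ_x ⊗ k)(δ_y ⊗ l) = δ_{x, k ▷ y} δ_x ⊗ kl`. -/
instance : Mul (Cross X K) :=
  ⟨fun a b => ⟨fun x k => ∑ l : K, a.coeff x l * b.coeff (l⁻¹ • x) (l⁻¹ * k)⟩⟩

theorem mul_coeff (a b : Cross X K) (x : X) (k : K) :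
    (a * b).coeff x k = ∑ l : K, a.coeff x l * b.coeff (l⁻¹ • x) (l⁻¹ * k) := rfl

instance : Ring (Cross X K) :=
  { (inferInstance : AddCommGroup (Cross X K)) with
    mul := (· * ·)
    one := 1
    mul_assoc := by
      intro a b c
      ext x k
      simp only [mul_coeff, Finset.sum_mul, Finset.mul_sum]
      rw [Finset.sum_comm]
      refine Finset.sum_congr rfl fun l _ => ?_
      refine Fintype.sum_equiv (Equiv.mulLeft l⁻¹) _ _ fun m => ?_
      simp [mul_assoc, mul_smul]
    one_mul := by
      intro a
      ext x k
      simp only [mul_coeff, one_coeff]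
      rw [Finset.sum_eq_single 1] <;> simp +contextual
    mul_one := by
      intro a
      ext x k
      simp only [mul_coeff, one_coeff]
      rw [Finset.sum_eq_single k]
      · simp
      · intro l _ hl
        have : l⁻¹ * k ≠ 1 := fun h => hl (by rw [inv_mul_eq_one] at h; exact h)
        simp [this]
      · simp
    left_distrib := by
      intro a b c
      ext x k
      simp [mul_coeff, mul_add, Finset.sum_add_distrib]
    right_distrib := by
      intro a b c
      ext x k
      simp [mul_coeff, add_mul, Finset.sum_add_distrib]
    zero_mul := by
      intro a
      ext x k
      simp [mul_coeff]
    mul_zero := by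
      intro a
      ext x k
      simp [mul_coeff] }

instance : Algebra ℂ (Cross X K) :=
  Algebra.ofModule
    (by intro z a b; ext x k; simp [mul_coeff, Finset.mul_sum, mul_assoc])
    (by intro z a b; ext x k; simp [mul_coeff, Finset.mul_sum, mul_left_comm])

theorem basis_mul_basis (x y : X) (k l : K) :
    basis x k * basis y l = if x = k • y then basis x (k * l) else 0 := by
  ext z m
  simp only [mul_coeff, basis_coeff]
  rw [Finset.sum_eq_single k]
  · by_cases hz : z = x
    · subst hz
      by_cases h : z = k • y
      · simp [h, basis_coeff, inv_mul_eq_iff_eq_mul]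
      · have h' : k⁻¹ • z ≠ y := fun e => h (by rw [← e, smul_inv_smul])
        simp [h, h']
    · split_ifs <;> simp_all [basis_coeff]
  · intro m _ hm
    simp [hm]
  · simp

/-- A covariant pair (projections `Q x` summing to `1` and a representation `U` of `K` with
`U k Q x = Q (k ▷ x) U k`) gives an algebra map with `δ_x ⊗ k ↦ Q x * U k`. -/
def covariant [Fintype X] {A : Type*} [Ring A] [Algebra ℂ A] (Q : X → A) (U : K →* A)
    (hQ : ∀ x y, Q x * Q y = if x = y then Q x else 0) (hsum : ∑ x, Q x = 1)
    (hUQ : ∀ k x, U k * Q x = Q (k • x) * U k) : Cross X K →ₐ[ℂ] A :=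
  AlgHom.ofLinearMap
    { toFun := fun a => ∑ x : X, ∑ k : K, a.coeff x k • (Q x * U k)
      map_add' := by
        intro a b
        simp [add_smul, Finset.sum_add_distrib]
      map_smul' := by
        intro z a
        simp [mul_smul, Finset.smul_sum] }
    (by
      simp [one_coeff, hsum])
    (by
      intro a b
      simp only [LinearMap.coe_mk, AddHom.coe_mk, mul_coeff, Finset.sum_smul]
      have key : ∀ (x y : X) (k l : K),
          (a.coeff x k • (Q x * U k)) * (b.coeff y l • (Q y * U l)) =
            if y = k⁻¹ • x then (a.coeff x k * b.coeff y l) • (Q x * U (k * l)) else 0 := by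
        intro x y k l
        have h1 : (Q x * U k) * (Q y * U l) = (Q x * Q (k • y)) * U (k * l) := by
          rw [mul_assoc, ← mul_assoc (U k), hUQ, map_mul]
          simp only [mul_assoc]
        rw [smul_mul_smul_comm, h1, hQ]
        by_cases h : y = k⁻¹ • x
        · subst h
          simp
        · have h' : x ≠ k • y := fun e => h (by rw [e, inv_smul_smul])
          simp [h, h']
      rw [Finset.sum_mul]
      refine Finset.sum_congr rfl fun x _ => ?_
      rw [Finset.sum_mul, Finset.sum_comm]
      refine Finset.sum_congr rfl fun k _ => ?_
      simp only [Finset.mul_sum, key]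
      rw [Finset.sum_eq_single (k⁻¹ • x)]
      · refine Fintype.sum_equiv (Equiv.mulLeft k⁻¹) _ _ fun l => ?_
        simp
      · intro y _ hy
        simp [hy]
      · simp)

/-- The element `k = ∑_x δ_x ⊗ k` of `ℂK ⊂ ℂ(X) ⋊ ℂK`. -/
def groupElem {X K : Type*} (k : K) : Cross X K := ⟨fun _ l => if l = k then 1 else 0⟩

theorem groupElem_coeff {X K : Type*} (k : K) (x : X) (l : K) :
    (groupElem k : Cross X K).coeff x l = if l = k then 1 else 0 := rfl

/-- The inclusion of `K` in `ℂ(X) ⋊ ℂK`. -/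
def ofGroup : K →* Cross X K where
  toFun := groupElem
  map_one' := rfl
  map_mul' k l := by
    ext x m
    rw [mul_coeff, Finset.sum_eq_single k]
    · simp [groupElem_coeff, inv_mul_eq_iff_eq_mul]
    · intro j _ hj
      simp [groupElem_coeff, hj]
    · simp

theorem ofGroup_coeff (k : K) (x : X) (l : K) :
    (ofGroup k : Cross X K).coeff x l = if l = k then 1 else 0 := rfl

end Cross

/-! ## Irreducible representations of crossed products and their projectors -/

/-- Data `(𝒪, ρ)` for a representation of `ℂ(X) ⋊ ℂK`: the orbit `𝒪` of a base point, a lift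
`κ : 𝒪 → K` with `κ_r ▷ r₀ = r` and `κ_{r₀} = e`, and a finite-dimensional representation `ρ` of
the isotropy group of the base point, written in a basis of its carrier space. -/
structure OrbitRep (X K : Type*) [Group K] [MulAction K X] where
  base : X
  lift : MulAction.orbit K base → K
  lift_smul : ∀ r, lift r • base = r
  lift_base : lift ⟨base, MulAction.mem_orbit_self base⟩ = 1
  dim : ℕ
  rep : MulAction.stabilizer K base →* Matrix (Fin dim) (Fin dim) ℂ

namespace OrbitRep

variable {X K : Type*} [Group K] [MulAction K X]

/-- `(𝒪, ρ)` labels an irrep: `ρ` is irreducible. -/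
def IsIrrep (a : OrbitRep X K) : Prop :=
  Representation.IsIrreducible
    (((Matrix.toLinAlgEquiv' : Matrix (Fin a.dim) (Fin a.dim) ℂ ≃ₐ[ℂ] _) :
      Matrix (Fin a.dim) (Fin a.dim) ℂ →* _).comp a.rep :
      Representation ℂ (MulAction.stabilizer K a.base) (Fin a.dim → ℂ))

/-- The cocycle `ζ_r(k) = κ_{k ▷ r}⁻¹ k κ_r`, with values in the isotropy group. -/
def cocycle (a : OrbitRep X K) (r : MulAction.orbit K a.base) (k : K) :
    MulAction.stabilizer K a.base :=
  ⟨(a.lift (k • r))⁻¹ * k * a.lift r, by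
    rw [MulAction.mem_stabilizer_iff, mul_smul, mul_smul, a.lift_smul, inv_smul_eq_iff,
      a.lift_smul, MulAction.orbit.coe_smul]⟩

theorem cocycle_mul (a : OrbitRep X K) (r : MulAction.orbit K a.base) (k l : K) :
    a.cocycle r (k * l) = a.cocycle (l • r) k * a.cocycle r l := by
  apply Subtype.ext
  simp [cocycle, mul_smul, mul_assoc]

/-- The carrier space `ℂ𝒪 ⊗ V_ρ`, as functions `𝒪 → V_ρ` (so that `s ⊗ v` is the function with
value `v` at `s` and `0` elsewhere). -/
abbrev Carrier (a : OrbitRep X K) : Type _ := MulAction.orbit K a.base → (Fin a.dim → ℂ)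

/-- `δ_x . (s ⊗ v) = δ_{x,s} s ⊗ v`. -/
def deltaAct (a : OrbitRep X K) (x : X) : Module.End ℂ a.Carrier where
  toFun f s := if (s : X) = x then f s else 0
  map_add' f g := by funext s; by_cases h : (s : X) = x <;> simp [h]
  map_smul' z f := by funext s; by_cases h : (s : X) = x <;> simp [h]

/-- `k . (s ⊗ v) = (k ▷ s) ⊗ ζ_s(k) . v`. -/
def groupAct (a : OrbitRep X K) : K →* Module.End ℂ a.Carrier where
  toFun k :=
    { toFun := fun f s => (a.rep (a.cocycle (k⁻¹ • s) k)).mulVec (f (k⁻¹ • s))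
      map_add' := by intro f g; funext s; simp [Matrix.mulVec_add]
      map_smul' := by intro z f; funext s; simp [Matrix.mulVec_smul] }
  map_one' := by
    refine LinearMap.ext fun f => funext fun s => ?_
    have h : a.cocycle s 1 = 1 := by
      apply Subtype.ext
      simp [cocycle]
    simp [h]
  map_mul' k l := by
    refine LinearMap.ext fun f => funext fun s => ?_
    simp [cocycle_mul, mul_smul, Matrix.mulVec_mulVec]

variable [Fintype K] [Fintype X]

/-- The representation of `ℂ(X) ⋊ ℂK` on `ℂ𝒪 ⊗ V_ρ`. -/
def action (a : OrbitRep X K) : Cross X K →ₐ[ℂ] Module.End ℂ a.Carrier :=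
  Cross.covariant a.deltaAct a.groupAct
    (by
      intro x y
      refine LinearMap.ext fun f => funext fun s => ?_
      by_cases hx : (s : X) = x
      · by_cases hxy : x = y
        · simp [deltaAct, hx, hxy]
        · simp [deltaAct, hx, hxy]
      · by_cases hxy : x = y
        · subst hxy
          simp [deltaAct, hx]
        · simp [deltaAct, hx, hxy])
    (by
      refine LinearMap.ext fun f => funext fun s => ?_
      simp [deltaAct])
    (by
      intro k x
      refine LinearMap.ext fun f => funext fun s => ?_
      have h : ((k⁻¹ • s : MulAction.orbit K a.base) : X) = x ↔ (s : X) = k • x := by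
        rw [MulAction.orbit.coe_smul, inv_smul_eq_iff]
      by_cases hs : (s : X) = k • x
      · simp [deltaAct, groupAct, hs]
      · have h' : ¬ (k⁻¹ • (s : X)) = x := by rwa [inv_smul_eq_iff]
        simp [deltaAct, groupAct, h', hs])

/-- The projector
`P_{(𝒪,ρ)} = (dim V_ρ / |K^{r₀}|) ∑_{r ∈ 𝒪} ∑_{n ∈ K^{r₀}} Tr_ρ(n⁻¹) δ_r ⊗ κ_r n κ_r⁻¹`. -/
def projector (a : OrbitRep X K) : Cross X K :=
  ((a.dim : ℂ) / (Fintype.card (MulAction.stabilizer K a.base) : ℂ)) •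
    ∑ r : MulAction.orbit K a.base, ∑ n : MulAction.stabilizer K a.base,
      (a.rep n⁻¹).trace • Cross.basis (r : X) (a.lift r * n * (a.lift r)⁻¹)

end OrbitRep

/-! ## The quantum double `D(G)` -/

/-- The set `G` with `G` acting on it by conjugation. -/
@[ext] structure Flux (G : Type*) where
  val : G

namespace Flux

variable {G : Type*}

/-- The bijection with `G`. -/
def equiv : Flux G ≃ G := ⟨Flux.val, Flux.mk, fun _ => rfl, fun _ => rfl⟩

instance [Fintype G] : Fintype (Flux G) := Fintype.ofEquiv G equiv.symm

variable [Group G]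

instance : SMul G (Flux G) := ⟨fun h c => ⟨h * c.val * h⁻¹⟩⟩

theorem smul_val (h : G) (c : Flux G) : (h • c).val = h * c.val * h⁻¹ := rfl

instance : MulAction G (Flux G) where
  one_smul c := by ext; simp [smul_val]
  mul_smul h k c := by ext; simp [smul_val, mul_assoc]

instance : Inv (Flux G) := ⟨fun c => ⟨c.val⁻¹⟩⟩

theorem inv_val (c : Flux G) : c⁻¹.val = c.val⁻¹ := rfl

theorem smul_inv (h : G) (c : Flux G) : h • c⁻¹ = (h • c)⁻¹ := by
  ext
  simp [smul_val, inv_val, mul_assoc]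

theorem inv_inv (c : Flux G) : c⁻¹⁻¹ = c := by
  ext
  simp [inv_val]

theorem inv_mem_orbit {c d : Flux G} (h : c ∈ MulAction.orbit G d⁻¹) :
    c⁻¹ ∈ MulAction.orbit G d := by
  obtain ⟨g, rfl⟩ := h
  refine ⟨g, ?_⟩
  show g • d = (g • d⁻¹)⁻¹
  rw [smul_inv, inv_inv]

theorem mem_stabilizer_of_inv {c : Flux G} {n : G} (h : n ∈ MulAction.stabilizer G c⁻¹) :
    n ∈ MulAction.stabilizer G c := by
  rw [MulAction.mem_stabilizer_iff] at h ⊢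
  rw [smul_inv] at h
  rw [← inv_inv (n • c), h, inv_inv]

end Flux

/-- `D(G) = ℂ(G) ⋊ ℂG`, with `h δ_g = δ_{hgh⁻¹} h`. -/
abbrev DG (G : Type*) : Type _ := Cross (Flux G) G

/-- The antipode `S(δ_g ⊗ h) = δ_{h⁻¹g⁻¹h} ⊗ h⁻¹`. -/
def antipode {G : Type*} [Group G] : DG G →ₗ[ℂ] DG G where
  toFun a := ⟨fun c k => a.coeff (k⁻¹ • c⁻¹) k⁻¹⟩
  map_add' _ _ := rfl
  map_smul' _ _ := rfl

theorem antipode_basis {G : Type*} [Group G] (g h : G) :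
    antipode (Cross.basis ⟨g⟩ h) = Cross.basis ⟨h⁻¹ * g⁻¹ * h⟩ h⁻¹ := by
  ext c k
  show (Cross.basis (⟨g⟩ : Flux G) h).coeff (k⁻¹ • c⁻¹) k⁻¹ = _
  rw [Cross.basis_coeff, Cross.basis_coeff]
  have : (k⁻¹ • c⁻¹ = (⟨g⟩ : Flux G) ∧ k⁻¹ = h) ↔ (c = ⟨h⁻¹ * g⁻¹ * h⟩ ∧ k = h⁻¹) := by
    constructor
    · rintro ⟨h1, rfl⟩
      have h2 : k⁻¹ * c.val⁻¹ * k = g := by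
        simpa [Flux.smul_val, Flux.inv_val] using congrArg Flux.val h1
      refine ⟨?_, by simp⟩
      ext
      rw [← h2]
      simp [mul_assoc]
    · rintro ⟨rfl, rfl⟩
      refine ⟨?_, by simp⟩
      ext
      simp [Flux.smul_val, Flux.inv_val, mul_assoc]
  simp only [this]

/-- The conjugate data `(𝒞*, π*)`: the class of `c₀⁻¹`, with `q_{c⁻¹} = q_c` and `π*` the dual of
`π` on the same isotropy group. -/
def conjugate {G : Type*} [Group G] (a : OrbitRep (Flux G) G) : OrbitRep (Flux G) G where
  base := a.base⁻¹
  lift c := a.lift ⟨(c : Flux G)⁻¹, Flux.inv_mem_orbit c.2⟩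
  lift_smul c := by
    rw [Flux.smul_inv, a.lift_smul, Flux.inv_inv]
  lift_base := by
    rw [← a.lift_base]
    congr 1
    exact Subtype.ext (Flux.inv_inv _)
  dim := a.dim
  rep :=
    { toFun := fun n => (a.rep (⟨n, Flux.mem_stabilizer_of_inv n.2⟩)⁻¹).transpose
      map_one' := by
        have : (⟨((1 : MulAction.stabilizer G a.base⁻¹) : G), Flux.mem_stabilizer_of_inv
            (1 : MulAction.stabilizer G a.base⁻¹).2⟩ : MulAction.stabilizer G a.base) = 1 := rfl
        rw [this]
        simp
      map_mul' := by
        intro m n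
        rw [← Matrix.transpose_mul, ← map_mul, ← mul_inv_rev]
        rfl }

/-! ## The boundary algebra `Ξ(R,K)` -/

/-- A transversal `R ∋ e` of the left cosets of `K`: every element of `G` is uniquely `rx` with
`r ∈ R` and `x ∈ K`. -/
structure Transversal {G : Type*} [Group G] (K : Subgroup G) where
  carrier : Set G
  isComplement : Subgroup.IsComplement carrier (K : Set G)
  one_mem : (1 : G) ∈ carrier

namespace Transversal

variable {G : Type*} [Group G] {K : Subgroup G}

instance : CoeSort (Transversal K) (Type _) := ⟨fun R => R.carrier⟩

instance (R : Transversal K) [Fintype G] : Fintype R := Fintype.ofFinite _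

/-- The bijection `R ≃ G/K`, `r ↦ rK`. -/
def toCoset (R : Transversal K) : R ≃ G ⧸ K := (R.isComplement.leftQuotientEquiv).symm

theorem toCoset_apply (R : Transversal K) (r : R) : R.toCoset r = ((r : G) : G ⧸ K) := rfl

/-- The action of `K` on `R` transported from its left action on `G/K`: `x ▷ r` is the
representative in `R` of the coset `xrK`. -/
instance (R : Transversal K) : MulAction K R := R.toCoset.mulAction K

theorem toCoset_smul (R : Transversal K) (x : K) (r : R) :
    R.toCoset (x • r) = x • R.toCoset r := by
  simp [Equiv.smul_def]

end Transversal

/-- `Ξ(R,K) = ℂ(R) ⋊ ℂK`. -/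
abbrev Xi {G : Type*} [Group G] {K : Subgroup G} (R : Transversal K) : Type _ := Cross R K

section Inclusion

variable {G : Type*} [Group G] [Fintype G] {K : Subgroup G} (R : Transversal K)

/-- `i(δ_r) = ∑_{x ∈ K} δ_{rx} = ∑_{g ∈ rK} δ_g`. -/
def inclDelta (r : R) : DG G :=
  ⟨fun c k => if k = 1 ∧ (c.val : G ⧸ K) = R.toCoset r then 1 else 0⟩

theorem inclDelta_coeff (r : R) (c : Flux G) (k : G) : (inclDelta R r).coeff c k =
    if k = 1 ∧ (c.val : G ⧸ K) = R.toCoset r then 1 else 0 := rfl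

/-- The inclusion of algebras `i : Ξ(R,K) → D(G)`, `i(δ_r) = ∑_{x ∈ K} δ_{rx}`, `i(x) = x`. -/
def incl : Xi R →ₐ[ℂ] DG G :=
  Cross.covariant (inclDelta R) ((Cross.ofGroup (X := Flux G) (K := G)).comp K.subtype)
    (by
      intro r s
      ext c k
      rw [Cross.mul_coeff, Finset.sum_eq_single 1]
      · by_cases hrs : r = s
        · subst hrs
          simp only [inclDelta_coeff, if_true, inv_one, one_smul, one_mul]
          split_ifs <;> simp_all
        · have h : R.toCoset r ≠ R.toCoset s := fun e => hrs (R.toCoset.injective e)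
          simp only [inclDelta_coeff, hrs, if_false, inv_one, one_smul, one_mul, Cross.zero_coeff]
          split_ifs <;> simp_all
      · intro l _ hl
        simp [inclDelta_coeff, hl]
      · simp)
    (by
      ext c k
      rw [Cross.sum_coeff, Cross.one_coeff]
      by_cases hk : k = 1
      · rw [Finset.sum_eq_single (R.toCoset.symm ((c.val : G) : G ⧸ K))]
        · simp [inclDelta_coeff, hk]
        · intro r _ hr
          have : ((c.val : G) : G ⧸ K) ≠ R.toCoset r := fun e => hr (by rw [e]; simp)
          simp [inclDelta_coeff, this]
        · simp
      · simp [inclDelta_coeff, hk])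
    (by
      intro x r
      ext c k
      rw [Cross.mul_coeff, Cross.mul_coeff, Finset.sum_eq_single (x : G),
        Finset.sum_eq_single (1 : G)]
      · have h : ((((x : G)⁻¹ • c).val : G) : G ⧸ K) = R.toCoset r ↔
            ((c.val : G) : G ⧸ K) = R.toCoset (x • r) := by
          rw [Transversal.toCoset_smul, Flux.smul_val]
          have e1 : (((x : G)⁻¹ * c.val * ((x : G)⁻¹)⁻¹ : G) : G ⧸ K) =
              ((x : G)⁻¹) • ((c.val : G) : G ⧸ K) := by
            rw [inv_inv, MulAction.Quotient.smul_coe, smul_eq_mul]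
            exact QuotientGroup.mk_mul_of_mem _ x.2
          rw [e1, inv_smul_eq_iff]
          rfl
        simp only [inclDelta_coeff, h, MonoidHom.comp_apply, Subgroup.subtype_apply, Cross.ofGroup_coeff]
        by_cases hk : k = x
        · simp [hk]
        · have hk' : (x : G)⁻¹ * k ≠ 1 := fun e => hk (by rw [inv_mul_eq_one] at e; exact e.symm)
          simp [hk, hk']
      · intro l _ hl
        simp [inclDelta_coeff, hl]
      · simp
      · intro l _ hl
        simp [Cross.ofGroup_coeff, hl]
      · simp)

/-- The `Ξ(R,K)`-module maps `V_{𝒪,ρ} → i^*(W_{𝒞,π})`. -/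
def restrictionHom (b : OrbitRep R K) (a : OrbitRep (Flux G) G) :
    Submodule ℂ (b.Carrier →ₗ[ℂ] a.Carrier) where
  carrier := {f | ∀ x : Xi R, f ∘ₗ b.action x = a.action (incl R x) ∘ₗ f}
  add_mem' := by
    intro f g hf hg x
    rw [LinearMap.add_comp, LinearMap.comp_add, hf x, hg x]
  zero_mem' := by
    intro x
    simp
  smul_mem' := by
    intro z f hf x
    rw [LinearMap.smul_comp, LinearMap.comp_smul, hf x]

/-- The multiplicity `n^{(𝒪,ρ)}_{(𝒞,π)} = dim Hom_Ξ(V_{𝒪,ρ}, i^*(W_{𝒞,π}))`. -/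
def multiplicity (b : OrbitRep R K) (a : OrbitRep (Flux G) G) : ℕ :=
  Module.finrank ℂ (restrictionHom R b a)

/-- The boundary projection `P_{i^*(𝒞,π)}`: the sum of the projectors `P_{(𝒪,ρ)}` of all the types
of irreps of `Ξ(R,K)` contained in `i^*(W_{𝒞,π})`.  Data labelling isomorphic irreps have the same
projector and nonisomorphic ones have distinct projectors, so this is a finite sum with one term
for each type. -/
def boundaryProjection (a : OrbitRep (Flux G) G) : Xi R :=
  ∑ᶠ e ∈ {e : Xi R | ∃ b : OrbitRep R K, b.IsIrrep ∧ multiplicity R b a ≠ 0 ∧ b.projector = e}, e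

end Inclusion

/-! ## The square lattice: darts, sites and steps between sites -/

/-- The four lattice directions, anticlockwise: east, north, west, south. -/
def dirVec : Fin 4 → ℤ × ℤ := ![(1, 0), (0, 1), (-1, 0), (0, -1)]

/-- An arrow of the square lattice `ℤ²` with its cartesian orientation: rightwards if `vertical`
is `false` and upwards if it is `true`. -/
@[ext] structure Arrow where
  tail : ℤ × ℤ
  vertical : Bool

namespace Arrow

/-- The vertex at which the arrow ends. -/
def head (e : Arrow) : ℤ × ℤ := e.tail + if e.vertical then (0, 1) else (1, 0)

/-- The face on the left of the arrow (faces are unit squares, named by their lower left corner). -/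
def leftFace (e : Arrow) : ℤ × ℤ := e.tail + if e.vertical then (-1, 0) else (0, 0)

/-- The face on the right of the arrow. -/
def rightFace (e : Arrow) : ℤ × ℤ := e.tail + if e.vertical then (0, 0) else (0, -1)

end Arrow

/-- An arrow traversed in one of the two directions: start vertex and direction. -/
@[ext] structure Dart where
  src : ℤ × ℤ
  dir : Fin 4

namespace Dart

/-- The end vertex of a dart. -/
def tgt (d : Dart) : ℤ × ℤ := d.src + dirVec d.dir

/-- Whether the dart goes along (rather than against) the arrow. -/
def Forward (d : Dart) : Prop := d.dir = 0 ∨ d.dir = 1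

/-- The underlying arrow of a dart. -/
def arrow (d : Dart) : Arrow :=
  ⟨if d.Forward then d.src else d.tgt, d.dir = 1 ∨ d.dir = 3⟩

end Dart

/-- A site `(v,p)`: a vertex `v` and one of the four faces at `v`, given by its quadrant as seen
from `v` (`0, 1, 2, 3` for north-east, north-west, south-west, south-east). -/
@[ext] structure Site where
  vert : ℤ × ℤ
  quad : Fin 4

/-- The face of a site. -/
def Site.face (s : Site) : ℤ × ℤ := s.vert + ![(0, 0), (-1, 0), (-1, -1), (0, -1)] s.quad

/-- The two possible orientations of a ribbon.  For `standard` ribbons the main path has the faces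
of the ribbon on its right: faces rotate anticlockwise about vertices and vertices move clockwise
around faces.  `mirrored` ribbons are the mirror images. -/
inductive Chirality
  | standard
  | mirrored

/-- The dart at the vertex of a site which a ribbon passing through this site next crosses or
traverses: for the standard orientation the one that comes anticlockwise from the site marker, which
is also the first one in the clockwise tour of the face. -/
def Site.next (o : Chirality) (s : Site) : Dart :=
  match o with
  | .standard => ⟨s.vert, s.quad + 1⟩
  | .mirrored => ⟨s.vert, s.quad⟩

/-- A ribbon is a sequence of triangles.  `cross` is a dual triangle: the vertex stays fixed and the
face changes, crossing an arrow at the vertex.  `walk` is a direct triangle: the face stays fixed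
and the vertex moves along an arrow of the face. -/
inductive Step
  | cross
  | walk

/-- The site reached from a site by a triangle. -/
def Site.step (o : Chirality) (s : Site) : Step → Site
  | .cross => match o with
    | .standard => ⟨s.vert, s.quad + 1⟩
    | .mirrored => ⟨s.vert, s.quad + 3⟩
  | .walk => match o with
    | .standard => ⟨(s.next o).tgt, s.quad + 3⟩
    | .mirrored => ⟨(s.next o).tgt, s.quad + 1⟩

/-- The last site of a sequence of triangles starting at `s`. -/
def lastSite (o : Chirality) : Site → List Step → Site
  | s, [] => s
  | s, x :: l => lastSite o (s.step o x) l

/-- The triangles of such a sequence, each given by its initial site and its kind. -/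
def triangles (o : Chirality) : Site → List Step → List (Site × Step)
  | _, [] => []
  | s, x :: l => (s, x) :: triangles o (s.step o x) l

/-! ## The lattice with smooth boundary, its state space and local operators

`P` is the set of faces of the lattice (finite or infinite; for the half-plane
`P = {p | 0 ≤ p.1}`).  The arrows of the lattice are those on the border of a face in `P`, so that
the boundary is smooth everywhere. -/

/-- The arrows of the lattice with set of faces `P`. -/
def LatticeArrow (P : Set (ℤ × ℤ)) : Type := {e : Arrow // e.leftFace ∈ P ∨ e.rightFace ∈ P}

/-- The state space `⨂_{arrows} ℂG`, a state being given by its coefficients in the group basis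
(for an infinite lattice all formal combinations are allowed). -/
abbrev State (P : Set (ℤ × ℤ)) (G : Type*) : Type _ := (LatticeArrow P → G) → ℂ

/-- A vertex of the bulk: all four faces around it belong to the lattice. -/
def IsBulkVertex (P : Set (ℤ × ℤ)) (v : ℤ × ℤ) : Prop := ∀ q : Fin 4, (Site.mk v q).face ∈ P

/-- A site in the bulk. -/
structure BulkSite (P : Set (ℤ × ℤ)) extends Site where
  isBulkVertex : IsBulkVertex P vert

/-- A site at the smooth boundary: its face lies outside the lattice, and its next arrow is a
boundary arrow, across which lies a face of the lattice.  For a boundary on the left hand side the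
vertex is at the top of the boundary arrow for the standard orientation and at the bottom for the
mirrored one. -/
structure BoundarySite (P : Set (ℤ × ℤ)) (o : Chirality) extends Site where
  face_notMem : toSite.face ∉ P
  face_mem : (toSite.step o .cross).face ∈ P

section Lattice

variable {G : Type*} [Group G] {P : Set (ℤ × ℤ)}

/-- The group element carried by a dart: `g` along an arrow with label `g`, `g⁻¹` against it, and
`e` for undefined arrows, which are skipped. -/
def value (σ : LatticeArrow P → G) (d : Dart) : G :=
  if h : d.arrow.leftFace ∈ P ∨ d.arrow.rightFace ∈ P then
    (if d.Forward then σ ⟨d.arrow, h⟩ else (σ ⟨d.arrow, h⟩)⁻¹)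
  else 1

/-- The effect of `h` at a vertex `v`: outgoing arrows `g ↦ hg`, incoming arrows `g ↦ gh⁻¹`. -/
def vertexMove (v : ℤ × ℤ) (h : G) (σ : LatticeArrow P → G) : LatticeArrow P → G := fun e =>
  (if e.1.tail = v then h else 1) * σ e * (if e.1.head = v then h⁻¹ else 1)

theorem vertexMove_mul (v : ℤ × ℤ) (h k : G) (σ : LatticeArrow P → G) :
    vertexMove v (h * k) σ = vertexMove v h (vertexMove v k σ) := by
  funext e
  by_cases h1 : e.1.tail = v <;> by_cases h2 : e.1.head = v <;>
    simp [vertexMove, h1, h2, mul_assoc]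

/-- The action `h ▷_v` of `G` at a vertex, `|σ⟩ ↦ |h ▷ σ⟩`. -/
def vertexAct (P : Set (ℤ × ℤ)) (v : ℤ × ℤ) : G →* Module.End ℂ (State P G) where
  toFun h :=
    { toFun := fun ψ σ => ψ (vertexMove v h⁻¹ σ)
      map_add' := fun _ _ => rfl
      map_smul' := fun _ _ => rfl }
  map_one' := by
    refine LinearMap.ext fun ψ => funext fun σ => ?_
    show ψ _ = ψ σ
    congr 1
    funext e
    simp [vertexMove]
  map_mul' h k := by
    refine LinearMap.ext fun ψ => funext fun σ => ?_
    show ψ _ = ψ _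
    rw [mul_inv_rev, vertexMove_mul]

/-- The diagonal operator `|σ⟩ ↦ δ(p(σ)) |σ⟩`. -/
def diag {H : Type*} (p : (LatticeArrow P → H) → Prop) : Module.End ℂ (State P H) where
  toFun ψ σ := if p σ then ψ σ else 0
  map_add' ψ φ := by funext σ; by_cases h : p σ <;> simp [h]
  map_smul' z ψ := by funext σ; by_cases h : p σ <;> simp [h]

/-- The product of the group elements around the face of a site, starting at its vertex and going
around once: clockwise for the standard orientation and anticlockwise for the mirrored one. -/
def holonomy (o : Chirality) (s : Site) (σ : LatticeArrow P → G) : G :=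
  value σ (s.next o) * value σ ((s.step o .walk).next o) *
    value σ (((s.step o .walk).step o .walk).next o) *
    value σ ((((s.step o .walk).step o .walk).step o .walk).next o)

/-- Direct triangle operator `T^g`: a factor `δ_g` on the value of the dart. -/
def directTriangle (d : Dart) (g : G) : Module.End ℂ (State P G) := diag fun σ => value σ d = g

/-- The dual triangle operation: multiplies the value of the dart by `h` from the left. -/
def crossMove (d : Dart) (h : G) (σ : LatticeArrow P → G) : LatticeArrow P → G := fun e =>
  if e.1 = d.arrow then (if d.Forward then h * σ e else σ e * h⁻¹) else σ e

/-- Dual triangle operator `L^h`, which acts on a single arrow at the vertex like `h ▷_v`. -/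
def dualTriangle (d : Dart) (h : G) : Module.End ℂ (State P G) where
  toFun ψ σ := ψ (crossMove d h⁻¹ σ)
  map_add' _ _ := rfl
  map_smul' _ _ := rfl

/-- Elementary ribbon operators: `F_τ^{h,g} = T_τ^g` and `F_{τ*}^{h,g} = δ_{g,e} L_{τ*}^h`. -/
def triangleOp : Step → Dart → G → G → Module.End ℂ (State P G)
  | .walk, d, _, g => directTriangle d g
  | .cross, d, h, g => if g = 1 then dualTriangle d h else 0

variable [Fintype G]

/-- Ribbon operators `F_ξ^{h,g}` of a sequence of triangles, by the concatenation rule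
`F_{ξ'∘ξ}^{h,g} = ∑_f F_{ξ'}^{f⁻¹hf, f⁻¹g} ∘ F_ξ^{h,f}`. -/
def ribbonOpAux (o : Chirality) : Site → List Step → G → G → Module.End ℂ (State P G)
  | _, [], _, g => if g = 1 then 1 else 0
  | s, x :: l, h, g =>
      ∑ f : G, ribbonOpAux o (s.step o x) l (f⁻¹ * h * f) (f⁻¹ * g) *
        triangleOp x (s.next o) h f

end Lattice

/-- A ribbon from a site at the boundary into the lattice: a strip of triangles from `s` to `t`.
After its start, which lies across the boundary, it stays inside the lattice, and the strip does not
overlap itself: no triangle occurs twice, and no arrow is both crossed and traversed. -/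
structure Ribbon (P : Set (ℤ × ℤ)) (o : Chirality) (s t : Site) where
  steps : List Step
  last_eq : lastSite o s steps = t
  face_mem : ∀ τ ∈ triangles o s steps, (τ.1.step o τ.2).face ∈ P
  nodup : (triangles o s steps).Nodup
  arrow_ne : ∀ τ ∈ triangles o s steps, ∀ τ' ∈ triangles o s steps,
    τ.2 = .cross → τ'.2 = .walk → (τ.1.next o).arrow ≠ (τ'.1.next o).arrow

section RibbonOperators

variable {G : Type*} [Group G] [Fintype G] {P : Set (ℤ × ℤ)} {o : Chirality} {s t : Site}

/-- The ribbon operator `F_ξ^{h,g}` in the group basis. -/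
def ribbonOp (ξ : Ribbon P o s t) (h g : G) : Module.End ℂ (State P G) :=
  ribbonOpAux o s ξ.steps h g

/-- The ribbon operator `F'_ξ^{𝒞,π;u,v} = ∑_{n ∈ G^{c₀}} π(n⁻¹)_{ji} F_ξ^{c, q_c n q_d⁻¹}` in the
quasiparticle basis, where `u = (c,i)` and `v = (d,j)`. -/
def quasiRibbonOp (ξ : Ribbon P o s t) (a : OrbitRep (Flux G) G)
    (u v : MulAction.orbit G a.base × Fin a.dim) : Module.End ℂ (State P G) :=
  ∑ n : MulAction.stabilizer G a.base,
    a.rep n⁻¹ v.2 u.2 •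
      ribbonOp ξ (u.1 : Flux G).val (a.lift u.1 * n * (a.lift v.1)⁻¹)

/-- The ribbon trace operator `W_ξ^{𝒞,π} = ∑_u F'_ξ^{𝒞,π;u,u}`. -/
def ribbonTrace (ξ : Ribbon P o s t) (a : OrbitRep (Flux G) G) : Module.End ℂ (State P G) :=
  ∑ u : MulAction.orbit G a.base × Fin a.dim, quasiRibbonOp ξ a u u

end RibbonOperators

/-! ## Site actions and the vacuum -/

section Actions

variable {G : Type*} [Group G] {P : Set (ℤ × ℤ)}

theorem diag_mul_diag {H : Type*} (p q : (LatticeArrow P → H) → Prop) :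
    diag p * diag q = diag fun σ => p σ ∧ q σ := by
  refine LinearMap.ext fun ψ => funext fun σ => ?_
  by_cases h1 : p σ <;> by_cases h2 : q σ <;> simp [diag, h1, h2]

theorem diag_false {H : Type*} : diag (fun _ : LatticeArrow P → H => False) = 0 := by
  refine LinearMap.ext fun ψ => funext fun σ => ?_
  simp [diag]

theorem vertexAct_mul_diag (v : ℤ × ℤ) (h : G) (p q : (LatticeArrow P → G) → Prop)
    (hpq : ∀ σ, p (vertexMove v h⁻¹ σ) ↔ q σ) :
    vertexAct P v h * diag p = diag q * vertexAct P v h := by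
  refine LinearMap.ext fun ψ => funext fun σ => ?_
  by_cases h1 : q σ
  · simp [diag, vertexAct, h1, (hpq σ).2 h1]
  · have h2 : ¬ p (vertexMove v h⁻¹ σ) := fun e => h1 ((hpq σ).1 e)
    simp [diag, vertexAct, h1, h2]

theorem value_vertexMove (v : ℤ × ℤ) (h : G) (σ : LatticeArrow P → G) (d : Dart)
    (hd : d.arrow.leftFace ∈ P ∨ d.arrow.rightFace ∈ P) :
    value (vertexMove v h σ) d =
      (if d.src = v then h else 1) * value σ d * (if d.tgt = v then h⁻¹ else 1) := by
  have hF : d.Forward → d.arrow.tail = d.src ∧ d.arrow.head = d.tgt := by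
    intro hf
    refine ⟨by simp [Dart.arrow, hf], ?_⟩
    rcases hf with hf | hf <;>
      simp [Dart.arrow, Arrow.head, Dart.tgt, dirVec, Dart.Forward, hf]
  have hB : ¬ d.Forward → d.arrow.tail = d.tgt ∧ d.arrow.head = d.src := by
    intro hf
    refine ⟨by simp [Dart.arrow, hf], ?_⟩
    obtain ⟨⟨x, y⟩, q⟩ := d
    fin_cases q <;> simp_all [Dart.arrow, Arrow.head, Dart.tgt, dirVec, Dart.Forward]
  by_cases hf : d.Forward
  · simp [value, hd, hf, vertexMove, hF hf]
  · simp only [value, hd, hf, vertexMove, hB hf, dif_pos, if_false]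
    by_cases h1 : d.src = v <;> by_cases h2 : d.tgt = v <;> simp [h1, h2, mul_assoc]

theorem next_arrow_mem (o : Chirality) (s : Site)
    (hs : s.face ∈ P ∨ (s.step o .cross).face ∈ P) :
    (s.next o).arrow.leftFace ∈ P ∨ (s.next o).arrow.rightFace ∈ P := by
  obtain ⟨⟨x, y⟩, q⟩ := s
  cases o <;> fin_cases q <;>
    simp_all [Site.next, Site.step, Site.face, Dart.arrow, Dart.Forward, Dart.tgt, dirVec,
      Arrow.leftFace, Arrow.rightFace, or_comm]

theorem step_walk_face (o : Chirality) (s : Site) : (s.step o .walk).face = s.face := by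
  obtain ⟨⟨x, y⟩, q⟩ := s
  cases o <;> fin_cases q <;>
    simp [Site.next, Site.step, Site.face, Dart.tgt, dirVec]

theorem next_src (o : Chirality) (s : Site) : (s.next o).src = s.vert := by
  cases o <;> rfl

theorem next_tgt (o : Chirality) (s : Site) : (s.next o).tgt = (s.step o .walk).vert := by
  cases o <;> rfl

theorem tgt_ne_src (d : Dart) : d.tgt ≠ d.src := by
  obtain ⟨⟨x, y⟩, q⟩ := d
  fin_cases q <;> simp [Dart.tgt, dirVec]

theorem walk_vert (o : Chirality) (s : Site) :
    (s.step o .walk).vert ≠ s.vert ∧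
    ((s.step o .walk).step o .walk).vert ≠ s.vert ∧
    (((s.step o .walk).step o .walk).step o .walk).vert ≠ s.vert ∧
    ((((s.step o .walk).step o .walk).step o .walk).step o .walk).vert = s.vert := by
  obtain ⟨⟨x, y⟩, q⟩ := s
  cases o <;> fin_cases q <;>
    simp [Site.next, Site.step, Dart.tgt, dirVec]

theorem holonomy_vertexMove (o : Chirality) (s : Site) (hs : s.face ∈ P) (h : G)
    (σ : LatticeArrow P → G) :
    holonomy o s (vertexMove s.vert h σ) = h * holonomy o s σ * h⁻¹ := by
  obtain ⟨h1, h2, h3, h4⟩ := walk_vert o s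
  have m : ∀ t : Site, t.face = s.face →
      (t.next o).arrow.leftFace ∈ P ∨ (t.next o).arrow.rightFace ∈ P := fun t ht =>
    next_arrow_mem o t (Or.inl (ht ▸ hs))
  have f1 := step_walk_face o s
  have f2 := (step_walk_face o (s.step o .walk)).trans f1
  have f3 := (step_walk_face o ((s.step o .walk).step o .walk)).trans f2
  simp only [holonomy]
  rw [value_vertexMove _ _ _ _ (m s rfl), value_vertexMove _ _ _ _ (m _ f1),
    value_vertexMove _ _ _ _ (m _ f2), value_vertexMove _ _ _ _ (m _ f3)]
  simp only [next_src, next_tgt, h1, h2, h3, h4, if_true, if_false, one_mul, mul_one]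
  simp only [mul_assoc]

variable [Fintype G]

/-- The action of `D(G)` at a site in the bulk, by `δ_g ▷` on the face (a factor
`δ_g(holonomy)`) and `h ▷` at the vertex.  The standard orientation gives the clockwise convention
for faces. -/
def bulkAct (o : Chirality) (s : BulkSite P) : DG G →ₐ[ℂ] Module.End ℂ (State P G) :=
  Cross.covariant (fun c : Flux G => diag fun σ => holonomy o s.toSite σ = c.val)
    (vertexAct P s.vert)
    (by
      intro c d
      rw [diag_mul_diag]
      by_cases h : c = d
      · subst h
        simp
      · rw [if_neg h, ← diag_false]
        congr 1
        funext σ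
        exact eq_false fun e => h (Flux.ext (e.1.symm.trans e.2)))
    (by
      refine LinearMap.ext fun ψ => funext fun σ => ?_
      simp only [LinearMap.sum_apply, Finset.sum_apply, Module.End.one_apply]
      rw [Finset.sum_eq_single ((⟨holonomy o s.toSite σ⟩ : Flux G))]
      · exact if_pos rfl
      · intro c _ hc
        exact if_neg fun e => hc (Flux.ext e.symm)
      · simp)
    (by
      intro h c
      apply vertexAct_mul_diag
      intro σ
      rw [holonomy_vertexMove o s.toSite (s.isBulkVertex s.quad), Flux.smul_val, inv_inv]
      constructor
      · intro e
        rw [← e]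
        group
      · intro e
        rw [e]
        group)

/-- The right action of `D(G)` at a bulk site: the left action composed with the antipode. -/
def bulkRightAct (o : Chirality) (s : BulkSite P) (ψ : State P G) (d : DG G) : State P G :=
  bulkAct o s (antipode d) ψ

/-- The action `▷^b` of `Ξ(R,K)` at a smooth boundary site: `x ∈ K` acts at the vertex on the
arrows present there, and `δ_r` gives a factor `δ_{rK}` of the value of the boundary arrow read
starting from the vertex of the site (clockwise around the outer face for the standard orientation,
anticlockwise for the mirrored one, undefined arrows being skipped). -/
def boundaryAct {K : Subgroup G} (R : Transversal K) {o : Chirality} (s : BoundarySite P o) :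
    Xi R →ₐ[ℂ] Module.End ℂ (State P G) :=
  Cross.covariant
    (fun r : R => diag fun σ => ((value σ (s.toSite.next o) : G) : G ⧸ K) = R.toCoset r)
    ((vertexAct P s.vert).comp K.subtype)
    (by
      intro c d
      rw [diag_mul_diag]
      by_cases h : c = d
      · subst h
        simp
      · rw [if_neg h, ← diag_false]
        congr 1
        funext σ
        exact eq_false fun e => h (R.toCoset.injective (e.1.symm.trans e.2)))
    (by
      refine LinearMap.ext fun ψ => funext fun σ => ?_
      simp only [LinearMap.sum_apply, Finset.sum_apply, Module.End.one_apply]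
      rw [Finset.sum_eq_single
        (R.toCoset.symm ((value σ (s.toSite.next o) : G) : G ⧸ K))]
      · exact if_pos (by simp)
      · intro c _ hc
        exact if_neg fun e => hc (by rw [e]; simp)
      · simp)
    (by
      intro x r
      apply vertexAct_mul_diag
      intro σ
      rw [value_vertexMove _ _ _ _ (next_arrow_mem o s.toSite (Or.inr s.face_mem)),
        Transversal.toCoset_smul, next_src, if_pos rfl,
        if_neg (by rw [← next_src o]; exact tgt_ne_src _), mul_one]
      have e1 : (((K.subtype x)⁻¹ * value σ (s.toSite.next o) : G) : G ⧸ K) =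
          x⁻¹ • ((value σ (s.toSite.next o) : G) : G ⧸ K) := rfl
      rw [e1, inv_smul_eq_iff])

/-- `A(v) = |G|⁻¹ ∑_h h ▷_v`. -/
def vertexProj (P : Set (ℤ × ℤ)) (v : ℤ × ℤ) : Module.End ℂ (State P G) :=
  (Fintype.card G : ℂ)⁻¹ • ∑ h : G, vertexAct P v h

/-- `B(p) = δ_e ▷`, read off at a site with face `p`. -/
def faceProj (s : Site) : Module.End ℂ (State P G) := diag fun σ => holonomy .standard s σ = 1

/-- `A₁ᵇ(v) = |K|⁻¹ ∑_{x ∈ K} x ▷_v`. -/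
def boundaryVertexProj (K : Subgroup G) (P : Set (ℤ × ℤ)) (v : ℤ × ℤ) :
    Module.End ℂ (State P G) :=
  (Fintype.card K : ℂ)⁻¹ • ∑ x : K, vertexAct P v (x : G)

/-- `B₁ᵇ = δ_e ▷^b` at a smooth boundary site: the boundary arrow takes values in `eK`. -/
def boundaryFaceProj (K : Subgroup G) {o : Chirality} (s : BoundarySite P o) :
    Module.End ℂ (State P G) := diag fun σ => value σ (s.toSite.next o) ∈ K

/-- Vacuum states: fixed by `A(v)` and `B(p)` for all vertices and faces of the bulk and by `A₁ᵇ`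
and `B₁ᵇ` at all sites of the smooth boundary. -/
structure IsVacuum (K : Subgroup G) (ψ : State P G) : Prop where
  vertex : ∀ v, IsBulkVertex P v → vertexProj P v ψ = ψ
  face : ∀ s : Site, s.face ∈ P → faceProj s ψ = ψ
  boundary_vertex : ∀ (o : Chirality) (s : BoundarySite P o), boundaryVertexProj K P s.vert ψ = ψ
  boundary_face : ∀ (o : Chirality) (s : BoundarySite P o), boundaryFaceProj K s ψ = ψ

end Actions

end QDouble

end

/-! The linear map `ribbonState` from D(G) to states, sending δ_c ⊗ g to F_ξ^{c,g}|vac⟩, turns the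
statement into algebra. It is injective (`ribbonState_injective`). It carries left multiplication by
i(b) to the boundary action of b ∈ Ξ(R,K) at s₀ (`boundaryAct_ribbonState`) and right multiplication
by d to the right action of d at s₁ (`bulkRightAct_ribbonState`). Up to the nonzero constant
`weight`, it sends the projector P_(𝒞,π) to W_ξ|vac⟩ (`ribbonState_projector`). What remains is
i(P_b) P_a = 0 ⟺ n = 0, i(P_{i^*a}) P_a = P_a, P_a P_a = P_a and S(P_a) = P_{a*}.

The algebra rests on the nondegenerate symmetric trace form `frob`. With respect to it P_a
represents `weight` times the character of V_a (`frob_mul_projector`), so P_a is central and d P_a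
depends only on how d acts on V_a. Schur orthogonality shows that P_a acts as 1 on V_a. Hence i(P_b)
P_a = 0 exactly when i(P_b) acts as 0 on W_a, and averaging rank one maps shows that this happens
exactly when there is no nonzero intertwiner V_b → W_a. The projectors nonzero on W_a act there with
sum 1, since the kernel of their sum would otherwise contain a vector fixed by one of them.

On the lattice, F^{h,g} has the closed form `ribbonOpAux_apply`: it requires the product of labels
along the strip to be g and evaluates the state on a configuration with the crossed arrows shifted
back by transported copies of h. Covariance of these two data under vertex moves gives the group
actions at the ends. The boundary label and the flux at s₁ are read off from the fact that the
vacuum is supported on flat configurations with boundary labels in K. -/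

set_option linter.unusedSectionVars false

namespace QDouble

/-! ### The trace form and bases of crossed products. -/

namespace Cross

variable {X K : Type*} [Group K] [MulAction K X] [Fintype K] [Fintype X]

/-- The symmetric Frobenius form `δ_x ⊗ k ↦ δ_{k,e}`. -/
def frob : Cross X K →ₗ[ℂ] ℂ where
  toFun a := ∑ x, a.coeff x 1
  map_add' a b := by simp [Finset.sum_add_distrib]
  map_smul' z a := by simp [Finset.mul_sum]

theorem frob_apply (a : Cross X K) : frob a = ∑ x, a.coeff x 1 := rfl

theorem frob_mul (a b : Cross X K) :
    frob (a * b) = ∑ x, ∑ l, a.coeff x l * b.coeff (l⁻¹ • x) l⁻¹ := by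
  simp [frob_apply, mul_coeff]

/-- The substitution (x, l) ↦ (l⁻¹ ▷ x, l⁻¹) is an involution which exchanges the two factors of
each summand of `frob_mul`. -/
theorem frob_mul_comm (a b : Cross X K) : frob (a * b) = frob (b * a) := by
  rw [frob_mul, frob_mul, ← Fintype.sum_prod_type', ← Fintype.sum_prod_type']
  refine Fintype.sum_equiv
    ⟨fun p => (p.2⁻¹ • p.1, p.2⁻¹), fun p => (p.2⁻¹ • p.1, p.2⁻¹), fun p => by simp,
      fun p => by simp⟩ _ _ fun p => ?_
  simp [mul_comm]

theorem frob_mul_basis (a : Cross X K) (y : X) (l : K) :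
    frob (a * basis y l) = a.coeff (l⁻¹ • y) l⁻¹ := by
  rw [frob_mul, Finset.sum_eq_single (l⁻¹ • y), Finset.sum_eq_single l⁻¹]
  · simp [basis_coeff]
  · intro m _ hm
    have : m⁻¹ ≠ l := fun h => hm (by rw [← h, inv_inv])
    simp [basis_coeff, this]
  · simp
  · intro x _ hx
    refine Finset.sum_eq_zero fun m _ => ?_
    rw [basis_coeff, if_neg, mul_zero]
    rintro ⟨h1, rfl⟩
    exact hx (by rw [← h1, inv_inv, smul_inv_smul])
  · simp

/-- Nondegeneracy: pairing with a basis element reads off one coefficient, so identities in the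
algebra can be checked as identities of traces. -/
theorem ext_frob {a b : Cross X K} (h : ∀ d, frob (d * a) = frob (d * b)) : a = b := by
  ext x k
  have := h (basis (k⁻¹ • x) k⁻¹)
  rw [frob_mul_comm, frob_mul_comm _ b, frob_mul_basis, frob_mul_basis] at this
  simpa using this

theorem covariant_basis {A : Type*} [Ring A] [Algebra ℂ A] (Q : X → A) (U : K →* A)
    (hQ : ∀ x y, Q x * Q y = if x = y then Q x else 0) (hsum : ∑ x, Q x = 1)
    (hUQ : ∀ k x, U k * Q x = Q (k • x) * U k) (x : X) (k : K) :
    covariant Q U hQ hsum hUQ (basis x k) = Q x * U k := by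
  show ∑ y : X, ∑ l : K, (basis x k).coeff y l • (Q y * U l) = _
  rw [Finset.sum_eq_single x, Finset.sum_eq_single k]
  · simp [basis_coeff]
  · intro l _ hl
    simp [basis_coeff, hl]
  · simp
  · intro y _ hy
    simp [basis_coeff, hy]
  · simp

theorem eq_sum_basis (a : Cross X K) : a = ∑ x, ∑ k, a.coeff x k • basis x k := by
  ext y l
  simp only [sum_coeff, smul_coeff, basis_coeff]
  rw [Finset.sum_eq_single y, Finset.sum_eq_single l]
  · simp
  · intro m _ hm
    simp [Ne.symm hm]
  · simp
  · intro x _ hx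
    simp [Ne.symm hx]
  · simp

theorem linearMap_ext {V : Type*} [AddCommMonoid V] [Module ℂ V] {f g : Cross X K →ₗ[ℂ] V}
    (h : ∀ x k, f (basis x k) = g (basis x k)) : f = g := by
  refine LinearMap.ext fun a => ?_
  rw [eq_sum_basis a]
  simp only [map_sum, map_smul, h]

theorem sum_basis (k : K) : ∑ x, basis x k = (ofGroup k : Cross X K) := by
  ext y l
  simp [sum_coeff, basis_coeff, ofGroup_coeff, ite_and]

theorem sum_basis_one : ∑ x, basis x 1 = (1 : Cross X K) := by
  rw [sum_basis, map_one]

instance : Module.Finite ℂ (Cross X K) :=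
  Module.Finite.equiv (LinearEquiv.ofBijective
    ({ toFun := fun f => ⟨f⟩, map_add' := fun _ _ => rfl, map_smul' := fun _ _ => rfl } :
      (X → K → ℂ) →ₗ[ℂ] Cross X K)
    ⟨fun _ _ h => congrArg Cross.coeff h, fun a => ⟨a.coeff, rfl⟩⟩)

end Cross

/-! ### Projectors as duals of characters under the trace form. -/

namespace OrbitRep

variable {X K : Type*} [Group K] [MulAction K X]

theorem cocycle_eq_of_fixed (a : OrbitRep X K) {r : MulAction.orbit K a.base} {k : K}
    (h : k • r = r) : (a.cocycle r k : K) = (a.lift r)⁻¹ * k * a.lift r := by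
  show (a.lift (k • r))⁻¹ * k * a.lift r = _
  rw [h]

variable [Fintype K] [Fintype X]

/-- The constant `dim V_ρ / |K^{r₀}|`. -/
noncomputable def weight (a : OrbitRep X K) : ℂ :=
  (a.dim : ℂ) / (Fintype.card (MulAction.stabilizer K a.base) : ℂ)

/-- The trace on the carrier space as a sum of diagonal entries. -/
theorem trace_carrier (a : OrbitRep X K) (T : Module.End ℂ a.Carrier) :
    LinearMap.trace ℂ a.Carrier T =
      ∑ s, ∑ i, T (Pi.single s (Pi.single i 1)) s i := by
  rw [LinearMap.trace_eq_matrix_trace ℂ (Pi.basis fun _ => Pi.basisFun ℂ (Fin a.dim)),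
    Matrix.trace, Fintype.sum_sigma]
  refine Finset.sum_congr rfl fun s _ => Finset.sum_congr rfl fun i _ => ?_
  simp [LinearMap.toMatrix_apply, Pi.basis_apply, Pi.basis_repr]

theorem trace_delta_group (a : OrbitRep X K) (x : X) (l : K) :
    LinearMap.trace ℂ a.Carrier (a.deltaAct x * a.groupAct l) =
      ∑ s : MulAction.orbit K a.base,
        if (s : X) = x ∧ l⁻¹ • s = s then (a.rep (a.cocycle s l)).trace else 0 := by
  rw [trace_carrier]
  refine Finset.sum_congr rfl fun s _ => ?_
  show ∑ i, (if (s : X) = x then (a.rep (a.cocycle (l⁻¹ • s) l)).mulVec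
    ((Pi.single s (Pi.single i 1) : a.Carrier) (l⁻¹ • s)) else 0) i = _
  by_cases hs : (s : X) = x
  · by_cases hl : l⁻¹ • s = s
    · simp [hs, hl, Matrix.trace]
    · simp [hs, hl]
  · simp [hs]

/-- Both sides are sums over the orbit. The term at r survives only if r = x and l fixes r, and then
a single isotropy element n has κ_r n κ_r⁻¹ = l⁻¹, namely the inverse of the cocycle of l at r. -/
theorem projector_coeff (a : OrbitRep X K) (x : X) (l : K) :
    a.projector.coeff (l⁻¹ • x) l⁻¹ =
      a.weight * LinearMap.trace ℂ a.Carrier (a.deltaAct x * a.groupAct l) := by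
  rw [trace_delta_group, projector, Cross.smul_coeff, Cross.sum_coeff]
  show a.weight * _ = _
  congr 1
  refine Finset.sum_congr rfl fun r _ => ?_
  rw [Cross.sum_coeff]
  simp only [Cross.smul_coeff, Cross.basis_coeff]
  by_cases h : (r : X) = x ∧ l⁻¹ • r = r
  · obtain ⟨h1, h2⟩ := h
    have h3 : l • r = r := by rw [← inv_smul_eq_iff.1 h2]
    have h4 : l⁻¹ • x = (r : X) := by
      rw [← h1, ← MulAction.orbit.coe_smul, h2]
    rw [if_pos ⟨h1, h2⟩, Finset.sum_eq_single (a.cocycle r l)⁻¹]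
    · rw [if_pos, inv_inv, mul_one]
      refine ⟨h4, ?_⟩
      rw [Subgroup.coe_inv, cocycle_eq_of_fixed a h3]
      group
    · intro n _ hn
      rw [if_neg, mul_zero]
      rintro ⟨-, h5⟩
      apply hn
      apply Subtype.ext
      rw [Subgroup.coe_inv, cocycle_eq_of_fixed a h3, ← inv_inj (a := (n : K))]
      have : l = (a.lift r) * (n : K)⁻¹ * (a.lift r)⁻¹ := by
        rw [← inv_inv l, h5]; group
      rw [this]
      group
    · simp
  · rw [if_neg h]
    refine Finset.sum_eq_zero fun n _ => ?_
    rw [if_neg, mul_zero]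
    rintro ⟨h4, h5⟩
    have h6 : l⁻¹ • r = r := by
      apply Subtype.ext
      have hn : (n : K) • a.base = a.base := n.2
      have hb : (a.lift r)⁻¹ • (r : X) = a.base := by
        rw [inv_smul_eq_iff, a.lift_smul]
      rw [MulAction.orbit.coe_smul, h5, mul_smul, mul_smul, hb, hn, a.lift_smul]
    refine h ⟨?_, h6⟩
    have : l⁻¹ • (r : X) = r := by rw [← MulAction.orbit.coe_smul, h6]
    have := h4.trans this.symm
    exact (smul_left_cancel _ this).symm

theorem action_basis (a : OrbitRep X K) (x : X) (k : K) :
    a.action (Cross.basis x k) = a.deltaAct x * a.groupAct k :=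
  Cross.covariant_basis _ _ _ _ _ x k

/-- This identity determines the projector and is the source of its formal properties: centrality
follows from symmetry of the traces on both sides, and the annihilation of P by everything that acts
as zero follows from nondegeneracy. -/
theorem frob_mul_projector (a : OrbitRep X K) (d : Cross X K) :
    Cross.frob (d * a.projector) = a.weight * LinearMap.trace ℂ a.Carrier (a.action d) := by
  have : (Cross.frob ∘ₗ LinearMap.mulRight ℂ a.projector) =
      a.weight • (LinearMap.trace ℂ a.Carrier ∘ₗ a.action.toLinearMap) := by
    refine Cross.linearMap_ext fun x l => ?_
    show Cross.frob (Cross.basis x l * a.projector) =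
      a.weight * LinearMap.trace ℂ a.Carrier (a.action (Cross.basis x l))
    rw [action_basis, ← projector_coeff, Cross.frob_mul_comm, Cross.frob_mul_basis]
  exact LinearMap.congr_fun this d

theorem projector_comm (a : OrbitRep X K) (d : Cross X K) :
    d * a.projector = a.projector * d := by
  refine Cross.ext_frob fun e => ?_
  rw [← mul_assoc, ← mul_assoc, Cross.frob_mul_comm _ d, ← mul_assoc, frob_mul_projector,
    frob_mul_projector, map_mul a.action, map_mul a.action, LinearMap.trace_mul_comm]

theorem mul_projector_eq_zero (a : OrbitRep X K) {d : Cross X K} (h : a.action d = 0) :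
    d * a.projector = 0 := by
  refine Cross.ext_frob fun e => ?_
  rw [← mul_assoc, frob_mul_projector, map_mul, h]
  simp

theorem mul_projector_congr (a : OrbitRep X K) {d e : Cross X K} (h : a.action d = a.action e) :
    d * a.projector = e * a.projector := by
  rw [← sub_eq_zero, ← sub_mul]
  exact mul_projector_eq_zero a (by rw [map_sub, h, sub_self])

end OrbitRep

end QDouble

/-! ### Schur orthogonality, central elements and orthogonality of projectors. -/

namespace QDouble

theorem irreducible_scalar {H V : Type*} [Group H] [AddCommGroup V] [Module ℂ V]
    [FiniteDimensional ℂ V] (ρ : Representation ℂ H V) (hρ : ρ.IsIrreducible) (f : V →ₗ[ℂ] V)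
    (hf : ∀ h v, f (ρ h v) = ρ h (f v)) : ∃ c : ℂ, f = c • LinearMap.id := by
  obtain ⟨c, hc⟩ :=
    (Representation.IsIrreducible.algebraMap_intertwiningMap_bijective_of_isAlgClosed
      (ρ := ρ)).2 (LinearMap.intertwiningMap_of_isIntertwiningMap ρ ρ f hf)
  refine ⟨c, LinearMap.ext fun v => ?_⟩
  have := congrArg (fun g : Representation.IntertwiningMap ρ ρ => g.toLinearMap v) hc
  exact this.symm

namespace OrbitRep

variable {X K : Type*} [Group K] [MulAction K X]

theorem dim_ne_zero (a : OrbitRep X K) (ha : a.IsIrrep) : a.dim ≠ 0 := by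
  intro h
  have hn := ha.toNontrivial
  obtain ⟨S, T, hST⟩ := hn
  apply hST
  have : IsEmpty (Fin a.dim) := by rw [h]; infer_instance
  apply Subrepresentation.toSubmodule_injective
  exact Subsingleton.elim _ _

theorem schur (a : OrbitRep X K) (ha : a.IsIrrep) (M : Matrix (Fin a.dim) (Fin a.dim) ℂ)
    (hM : ∀ n, M * a.rep n = a.rep n * M) : ∃ c : ℂ, M = c • 1 := by
  obtain ⟨c, hc⟩ := irreducible_scalar _ ha (Matrix.toLin' M) (by
    intro n v
    show Matrix.toLin' M (Matrix.toLin' (a.rep n) v) = Matrix.toLin' (a.rep n) (Matrix.toLin' M v)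
    rw [← Matrix.toLin'_mul_apply, hM, Matrix.toLin'_mul_apply])
  refine ⟨c, Matrix.toLin'.injective ?_⟩
  rw [hc, map_smul, Matrix.toLin'_one]

variable [Fintype K] [Fintype X]

/-- Averaging the matrix unit E_{ij} over the isotropy group gives a matrix commuting with ρ, hence
a scalar c by Schur's lemma. Taking traces gives |K^{r₀}| δ_{ij} = c dim V_ρ, and the (k,l) entry is
the sum in question. -/
theorem schur_orthogonality (a : OrbitRep X K) (ha : a.IsIrrep) (i j k l : Fin a.dim) :
    ∑ n, a.rep n k i * a.rep n⁻¹ j l =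
      if i = j ∧ k = l then a.weight⁻¹ else 0 := by
  set E : Matrix (Fin a.dim) (Fin a.dim) ℂ := Matrix.single i j 1
  have hinv : ∀ n, a.rep n⁻¹ * a.rep n = 1 := fun n => by rw [← map_mul]; simp
  obtain ⟨c, hc⟩ := a.schur ha (∑ n, a.rep n * E * a.rep n⁻¹) (by
    intro m
    rw [Finset.sum_mul, Finset.mul_sum]
    refine Fintype.sum_equiv (Equiv.mulLeft m⁻¹) _ _ fun n => ?_
    simp only [Equiv.coe_mulLeft, map_mul, mul_inv_rev, inv_inv, ← mul_assoc]
    rw [← map_mul a.rep m m⁻¹]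
    simp)
  have hd : (a.dim : ℂ) ≠ 0 := Nat.cast_ne_zero.2 (a.dim_ne_zero ha)
  have htr : (Fintype.card (MulAction.stabilizer K a.base) : ℂ) * (if i = j then 1 else 0) =
      c * a.dim := by
    have := congrArg Matrix.trace hc
    rw [Matrix.trace_sum] at this
    simp only [Matrix.trace_mul_cycle (a.rep _) E, hinv, one_mul] at this
    simp only [E, Matrix.trace_smul, Matrix.trace_one] at this
    by_cases hij : i = j
    · subst hij
      simpa using this
    · simpa [hij, Matrix.trace_single_eq_of_ne _ _ _ hij] using this
  have hcv : c = if i = j then a.weight⁻¹ else 0 := by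
    rw [eq_comm, ← eq_div_iff hd] at htr
    rw [htr, weight]
    split_ifs <;> simp
  have hkl := congrFun (congrFun hc k) l
  rw [Matrix.sum_apply] at hkl
  have hterm : ∀ n, (a.rep n * E * a.rep n⁻¹) k l = a.rep n k i * a.rep n⁻¹ j l := by
    intro n
    rw [Matrix.mul_apply, Finset.sum_eq_single j]
    · simp [E]
    · intro m _ hm
      simp [E, Matrix.mul_single_apply_of_ne _ _ _ _ _ hm]
    · simp
  simp only [hterm] at hkl
  rw [hkl, hcv]
  by_cases h1 : i = j <;> by_cases h2 : k = l <;> simp [h1, h2]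

theorem weight_ne_zero (a : OrbitRep X K) (ha : a.IsIrrep) : a.weight ≠ 0 :=
  div_ne_zero (Nat.cast_ne_zero.2 (a.dim_ne_zero ha)) (Nat.cast_ne_zero.2 Fintype.card_ne_zero)

theorem sum_trace_smul_rep (a : OrbitRep X K) (ha : a.IsIrrep) :
    a.weight • ∑ n, (a.rep n⁻¹).trace • a.rep n = 1 := by
  ext k i
  rw [Matrix.smul_apply, Matrix.sum_apply]
  have : ∀ n, ((a.rep n⁻¹).trace • a.rep n) k i = ∑ j, a.rep n k i * a.rep n⁻¹ j j := by
    intro n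
    rw [Matrix.smul_apply, smul_eq_mul, mul_comm, Matrix.trace, Finset.mul_sum]
    rfl
  simp only [this]
  rw [Finset.sum_comm]
  simp only [a.schur_orthogonality ha]
  by_cases h : k = i
  · subst h
    rw [Finset.sum_eq_single k]
    · simp [a.weight_ne_zero ha]
    · intro j _ hj
      simp [Ne.symm hj]
    · simp
  · rw [Finset.sum_eq_zero]
    · simp [h]
    · intro j _
      rw [if_neg]
      rintro ⟨rfl, rfl⟩
      exact h rfl

/-- At a point s of the orbit only the summand r = s contributes. There κ_s n κ_s⁻¹ fixes s and acts
on the fibre as ρ(n), so `sum_trace_smul_rep` applies. -/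
theorem action_projector (a : OrbitRep X K) (ha : a.IsIrrep) : a.action a.projector = 1 := by
  refine LinearMap.ext fun f => funext fun s => ?_
  have h1 : a.action a.projector =
      a.weight • ∑ r : MulAction.orbit K a.base, ∑ n : MulAction.stabilizer K a.base,
        (a.rep n⁻¹).trace • (a.deltaAct r * a.groupAct (a.lift r * n * (a.lift r)⁻¹)) := by
    rw [projector, map_smul, map_sum]
    simp only [map_sum, map_smul, action_basis]
    rfl
  have h2 : ∀ n : MulAction.stabilizer K a.base,
      a.groupAct (a.lift s * n * (a.lift s)⁻¹) f s = (a.rep n).mulVec (f s) := by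
    intro n
    set g := a.lift s * n * (a.lift s)⁻¹
    have hb : (a.lift s)⁻¹ • (s : X) = a.base := by
      rw [inv_smul_eq_iff, a.lift_smul]
    have hg : g • s = s := by
      apply Subtype.ext
      have hn : (n : K) • a.base = a.base := n.2
      rw [MulAction.orbit.coe_smul, mul_smul, mul_smul, hb, hn, a.lift_smul]
    have hg' : g⁻¹ • s = s := by rw [inv_smul_eq_iff, hg]
    show (a.rep (a.cocycle (g⁻¹ • s) g)).mulVec (f (g⁻¹ • s)) = _
    rw [hg']
    congr 2
    apply Subtype.ext
    rw [a.cocycle_eq_of_fixed hg]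
    simp only [g]
    group
  rw [h1, LinearMap.smul_apply, LinearMap.sum_apply, Pi.smul_apply, Finset.sum_apply,
    Finset.sum_eq_single s]
  · rw [LinearMap.sum_apply, Finset.sum_apply]
    have h3 : ∀ n : MulAction.stabilizer K a.base,
        (((a.rep n⁻¹).trace • (a.deltaAct s * a.groupAct (a.lift s * n * (a.lift s)⁻¹))) f) s =
          ((a.rep n⁻¹).trace • a.rep n).mulVec (f s) := by
      intro n
      rw [Matrix.smul_mulVec, ← h2]
      simp [deltaAct]
    simp only [h3]
    rw [← Matrix.sum_mulVec, ← Matrix.smul_mulVec, a.sum_trace_smul_rep ha]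
    simp
  · intro r _ hr
    have : (s : X) ≠ r := fun h => hr (Subtype.ext h.symm)
    simp [deltaAct, this]
  · simp

theorem projector_mul_self (a : OrbitRep X K) (ha : a.IsIrrep) :
    a.projector * a.projector = a.projector := by
  have := a.mul_projector_congr (d := a.projector) (e := 1) (by
    rw [a.action_projector ha, map_one])
  rwa [one_mul] at this

theorem groupAct_single (a : OrbitRep X K) (k : K) (r : MulAction.orbit K a.base)
    (v : Fin a.dim → ℂ) :
    a.groupAct k (Pi.single r v) = Pi.single (k • r) ((a.rep (a.cocycle r k)).mulVec v) := by
  funext s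
  show (a.rep (a.cocycle (k⁻¹ • s) k)).mulVec ((Pi.single r v : a.Carrier) (k⁻¹ • s)) = _
  by_cases h : s = k • r
  · subst h
    simp
  · have : k⁻¹ • s ≠ r := fun e => h (by rw [← e, smul_inv_smul])
    simp [h, this]

theorem deltaAct_single (a : OrbitRep X K) (r : MulAction.orbit K a.base)
    (v : Fin a.dim → ℂ) :
    a.deltaAct r (Pi.single r v) = Pi.single r v := by
  funext s
  show (if (s : X) = r then (Pi.single r v : a.Carrier) s else 0) = _
  by_cases h : s = r
  · simp [h]
  · simp [h]

/-- The base point as an element of its orbit. -/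
def basePt (a : OrbitRep X K) : MulAction.orbit K a.base := ⟨a.base, MulAction.mem_orbit_self _⟩

/-- Commuting with the δ's, a central element preserves the fibre over the base point. Commuting
with the isotropy group, it is a scalar there by Schur's lemma. The lifts carry this scalar to every
other fibre. -/
theorem action_central (a : OrbitRep X K) (ha : a.IsIrrep) (z : Cross X K)
    (hz : ∀ d, d * z = z * d) : ∃ c : ℂ, a.action z = c • 1 := by
  set Z := a.action z
  have hd : ∀ x f, Z (a.deltaAct x f) = a.deltaAct x (Z f) := by
    intro x f
    have : Z * a.deltaAct x = a.deltaAct x * Z := by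
      have h1 : a.action (Cross.basis x 1) = a.deltaAct x := by rw [action_basis]; simp
      rw [← h1, ← map_mul, ← map_mul, hz]
    exact LinearMap.congr_fun this f
  have hg : ∀ k f, Z (a.groupAct k f) = a.groupAct k (Z f) := by
    intro k f
    have : Z * a.groupAct k = a.groupAct k * Z := by
      have h1 : a.action (Cross.ofGroup k) = a.groupAct k := by
        rw [← Cross.sum_basis, map_sum]
        simp only [action_basis]
        rw [← Finset.sum_mul]
        have : ∑ x, a.deltaAct x = 1 := by
          refine LinearMap.ext fun f => funext fun s => ?_
          simp [deltaAct]
        rw [this, one_mul]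
      rw [← h1, ← map_mul, ← map_mul, hz]
    exact LinearMap.congr_fun this f
  -- The diagonal block of `Z` at the base point.
  set N : Module.End ℂ (Fin a.dim → ℂ) :=
    { toFun := fun v => Z (Pi.single a.basePt v) a.basePt
      map_add' := by intro v w; rw [Pi.single_add, map_add, Pi.add_apply]
      map_smul' := by intro c v; rw [Pi.single_smul, map_smul]; rfl }
  have hN : ∀ v, Z (Pi.single a.basePt v) = Pi.single a.basePt (N v) := by
    intro v
    funext s
    rw [← a.deltaAct_single a.basePt v, hd]
    show (if (s : X) = a.basePt then Z (Pi.single a.basePt v) s else 0) = _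
    by_cases h : s = a.basePt
    · subst h
      simp [N]
    · simp [h, Subtype.ext_iff.not.1 h]
  have hcoc : ∀ n : MulAction.stabilizer K a.base, (n : K) • a.basePt = a.basePt :=
    fun n => Subtype.ext n.2
  have hcoc' : ∀ n : MulAction.stabilizer K a.base, a.cocycle a.basePt n = n := by
    intro n
    apply Subtype.ext
    rw [a.cocycle_eq_of_fixed (hcoc n), basePt, a.lift_base]
    simp
  obtain ⟨c, hc⟩ := irreducible_scalar _ ha N (by
    intro n v
    have h1 := hg n (Pi.single a.basePt v)
    rw [groupAct_single, hcoc, hcoc', hN, hN, groupAct_single, hcoc, hcoc'] at h1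
    exact Pi.single_injective _ h1)
  refine ⟨c, LinearMap.pi_ext fun s v => ?_⟩
  have hs : a.lift s • a.basePt = s := Subtype.ext (a.lift_smul s)
  have hs' : a.cocycle a.basePt (a.lift s) = 1 := by
    apply Subtype.ext
    show (a.lift (a.lift s • a.basePt))⁻¹ * a.lift s * a.lift a.basePt = 1
    rw [hs, basePt, a.lift_base]
    simp
  have h1 : a.groupAct (a.lift s) (Pi.single a.basePt v) = Pi.single s v := by
    rw [groupAct_single, hs, hs']
    simp
  rw [← h1, hg, hN, hc]
  rw [LinearMap.smul_apply, LinearMap.id_apply, Pi.single_smul, map_smul]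
  rfl

theorem action_central_idempotent (a : OrbitRep X K) (ha : a.IsIrrep) (z : Cross X K)
    (hz : ∀ d, d * z = z * d) (hi : z * z = z) : a.action z = 0 ∨ a.action z = 1 := by
  obtain ⟨c, hc⟩ := a.action_central ha z hz
  have h1 : (c * c) • (1 : Module.End ℂ a.Carrier) = c • 1 := by
    rw [← hc, ← hi, map_mul, hc, smul_mul_smul_comm, one_mul]
  by_cases h0 : c = 0
  · left
    rw [hc, h0, zero_smul]
  · right
    have := congrArg (fun T => c⁻¹ • T) h1
    simp only [smul_smul, inv_mul_cancel_left₀ h0, inv_mul_cancel₀ h0, one_smul] at this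
    rw [hc, this]

theorem action_one_ne_zero (a : OrbitRep X K) (ha : a.IsIrrep) :
    (1 : Module.End ℂ a.Carrier) ≠ 0 := by
  intro h
  have : NeZero a.dim := ⟨a.dim_ne_zero ha⟩
  have h2 := congrFun (congrFun (LinearMap.congr_fun h (fun _ _ => 1)) a.basePt) 0
  simp at h2

theorem projector_ne_zero (a : OrbitRep X K) (ha : a.IsIrrep) : a.projector ≠ 0 := by
  intro h
  have := a.action_projector ha
  rw [h, map_zero] at this
  exact a.action_one_ne_zero ha this.symm

/-- Each projector is a central idempotent, so it acts as 0 or 1 on the other's irrep. A 0 makes the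
product vanish. If both act as 1, each absorbs the other and the two coincide. -/
theorem projector_orthogonal (a b : OrbitRep X K) (ha : a.IsIrrep) (hb : b.IsIrrep)
    (hab : a.projector ≠ b.projector) : a.projector * b.projector = 0 := by
  rcases b.action_central_idempotent hb _ a.projector_comm (a.projector_mul_self ha) with h | h
  · exact b.mul_projector_eq_zero h
  have h1 : a.projector * b.projector = b.projector := by
    have := b.mul_projector_congr (d := a.projector) (e := 1) (by rw [h, map_one])
    rwa [one_mul] at this
  rcases a.action_central_idempotent ha _ b.projector_comm (b.projector_mul_self hb) with h' | h'
  · rw [b.projector_comm]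
    exact a.mul_projector_eq_zero h'
  · have h2 := a.mul_projector_congr (d := b.projector) (e := 1) (by rw [h', map_one])
    rw [one_mul, a.projector_comm, h1] at h2
    exact absurd h2.symm hab

end OrbitRep

end QDouble

/-! ### Intertwiners by averaging, and irreps on invariant subspaces. -/

namespace QDouble

namespace OrbitRep

variable {X K : Type*} [Group K] [MulAction K X] [Fintype K] [Fintype X]
variable {W : Type*} [AddCommGroup W] [Module ℂ W]

theorem action_eq_of_basis (a : OrbitRep X K) (A : Cross X K →ₐ[ℂ] Module.End ℂ W)
    (f : a.Carrier →ₗ[ℂ] W)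
    (h : ∀ x k v, f (a.action (Cross.basis x k) v) = A (Cross.basis x k) (f v)) (d : Cross X K) :
    f ∘ₗ a.action d = A d ∘ₗ f := by
  refine LinearMap.ext fun v => ?_
  rw [Cross.eq_sum_basis d]
  simp only [map_sum, map_smul, LinearMap.comp_apply, LinearMap.sum_apply, LinearMap.smul_apply, h]

/-- The average of a rank one map `V_{𝒪,ρ} → W`, which intertwines the actions. -/
noncomputable def average (a : OrbitRep X K) (A : Cross X K →ₐ[ℂ] Module.End ℂ W)
    (φ : a.Carrier →ₗ[ℂ] ℂ) (w : W) : a.Carrier →ₗ[ℂ] W :=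
  ∑ x : X, ∑ k : K, (φ ∘ₗ a.action (Cross.basis (k⁻¹ • x) k⁻¹)).smulRight (A (Cross.basis x k) w)

theorem average_apply (a : OrbitRep X K) (A : Cross X K →ₐ[ℂ] Module.End ℂ W)
    (φ : a.Carrier →ₗ[ℂ] ℂ) (w : W) (v : a.Carrier) :
    a.average A φ w v = ∑ x : X, ∑ k : K,
      φ (a.action (Cross.basis (k⁻¹ • x) k⁻¹) v) • A (Cross.basis x k) w := by
  simp [average]

/-- The families δ_x ⊗ k and δ_{k⁻¹ ▷ x} ⊗ k⁻¹ are dual bases for `frob`, so the average is taken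
against the Casimir element. Reindexing by k ↦ l⁻¹k moves a basis element from one factor to the
other. -/
theorem average_intertwines (a : OrbitRep X K) (A : Cross X K →ₐ[ℂ] Module.End ℂ W)
    (φ : a.Carrier →ₗ[ℂ] ℂ) (w : W) (d : Cross X K) :
    a.average A φ w ∘ₗ a.action d = A d ∘ₗ a.average A φ w := by
  refine a.action_eq_of_basis A _ (fun y l v => ?_) d
  rw [average_apply, average_apply]
  simp only [map_sum, map_smul, ← Module.End.mul_apply, ← map_mul, Cross.basis_mul_basis,
    smul_left_cancel_iff]
  rw [Finset.sum_eq_single y, Finset.sum_eq_single (l⁻¹ • y)]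
  · refine Fintype.sum_equiv (Equiv.mulLeft l⁻¹) _ _ fun k => ?_
    simp [mul_smul]
  · intro x _ hx
    refine Finset.sum_eq_zero fun k _ => ?_
    rw [if_neg, map_zero, LinearMap.zero_apply, smul_zero]
    intro h
    exact hx (by rw [h, inv_smul_smul])
  · simp
  · intro x _ hx
    refine Finset.sum_eq_zero fun k _ => ?_
    rw [if_neg hx, map_zero, LinearMap.zero_apply, map_zero, zero_smul]
  · simp

/-- The coefficients of the projector are traces of the dual basis elements. Expanding each trace
into diagonal entries exhibits the projector's image as a sum of values of intertwiners. -/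
theorem sum_average (a : OrbitRep X K) (A : Cross X K →ₐ[ℂ] Module.End ℂ W) (w : W) :
    A a.projector w = a.weight • ∑ s, ∑ i,
      a.average A (LinearMap.proj i ∘ₗ LinearMap.proj s) w (Pi.single s (Pi.single i 1)) := by
  have h1 : ∀ x k, a.projector.coeff x k =
      a.weight * ∑ s, ∑ i,
        a.action (Cross.basis (k⁻¹ • x) k⁻¹) (Pi.single s (Pi.single i 1)) s i := by
    intro x k
    have := a.projector_coeff (k⁻¹ • x) k⁻¹
    rw [inv_inv, smul_inv_smul, ← action_basis, trace_carrier] at this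
    exact this
  conv_lhs => rw [Cross.eq_sum_basis a.projector]
  simp only [average_apply, map_sum, map_smul, LinearMap.sum_apply, LinearMap.smul_apply, h1,
    Finset.smul_sum, Finset.mul_sum, Finset.sum_smul, smul_smul, LinearMap.comp_apply,
    LinearMap.proj_apply]
  simp only [← Fintype.sum_prod_type']
  refine Fintype.sum_equiv ⟨fun p => (p.2.2.1, p.2.2.2, p.1, p.2.1),
    fun q => (q.2.2.1, q.2.2.2, q.1, q.2.1), fun _ => rfl, fun _ => rfl⟩ _ _ fun p => ?_
  simp only [Equiv.coe_fn_mk]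

/-- An intertwiner f satisfies f = f ∘ P = P ∘ f, as P acts as 1 on V, so it vanishes if P does on
W. Conversely, `sum_average` writes P w through intertwiners. No finiteness of W is needed. -/
theorem apply_projector_eq_zero_iff (a : OrbitRep X K) (ha : a.IsIrrep)
    (A : Cross X K →ₐ[ℂ] Module.End ℂ W) :
    A a.projector = 0 ↔
      ∀ f : a.Carrier →ₗ[ℂ] W, (∀ d, f ∘ₗ a.action d = A d ∘ₗ f) → f = 0 := by
  constructor
  · intro h f hf
    have := hf a.projector
    rwa [h, a.action_projector ha, LinearMap.zero_comp, Module.End.one_eq_id,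
      LinearMap.comp_id] at this
  · intro h
    refine LinearMap.ext fun w => ?_
    rw [sum_average]
    simp only [h _ (a.average_intertwines A _ w)]
    simp

/-- A copy of ρ inside δ_{r₀}W is already fixed by P. Only r = r₀ contributes, because κ_r n κ_r⁻¹
takes r₀ to r only when r = r₀; the surviving terms are those of `sum_trace_smul_rep`. -/
theorem apply_projector_of_isotypic (a : OrbitRep X K) (ha : a.IsIrrep)
    (A : Cross X K →ₐ[ℂ] Module.End ℂ W) (ι : (Fin a.dim → ℂ) →ₗ[ℂ] W)
    (hδ : ∀ v, A (Cross.basis a.base 1) (ι v) = ι v)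
    (hn : ∀ (n : MulAction.stabilizer K a.base) v,
      A (Cross.ofGroup (n : K)) (ι v) = ι ((a.rep n).mulVec v)) (v : Fin a.dim → ℂ) :
    A a.projector (ι v) = ι v := by
  have hn' : ∀ (n : MulAction.stabilizer K a.base) v,
      A (Cross.basis a.base (n : K)) (ι v) = ι ((a.rep n).mulVec v) := by
    intro n v
    have : Cross.basis a.base (n : K) = Cross.basis a.base 1 * Cross.ofGroup (n : K) := by
      rw [← Cross.sum_basis, Finset.mul_sum]
      simp [Cross.basis_mul_basis]
    rw [this, map_mul, Module.End.mul_apply, hn, hδ]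
  rw [projector, map_smul, map_sum, LinearMap.smul_apply, LinearMap.sum_apply,
    Finset.sum_eq_single a.basePt]
  · simp only [map_sum, map_smul, LinearMap.sum_apply, LinearMap.smul_apply]
    have h1 : a.lift a.basePt = 1 := a.lift_base
    have h2 : (a.basePt : X) = a.base := rfl
    simp only [h1, h2, one_mul, inv_one, mul_one, hn']
    simp only [← map_smul, ← Matrix.smul_mulVec]
    rw [← map_sum, ← Matrix.sum_mulVec, ← map_smul, ← Matrix.smul_mulVec]
    have := a.sum_trace_smul_rep ha
    rw [weight] at this
    rw [this, Matrix.one_mulVec]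
  · intro r _ hr
    rw [map_sum, LinearMap.sum_apply]
    refine Finset.sum_eq_zero fun n _ => ?_
    rw [map_smul, LinearMap.smul_apply, ← hδ, ← Module.End.mul_apply, ← map_mul,
      Cross.basis_mul_basis, if_neg, map_zero, LinearMap.zero_apply, smul_zero]
    intro h
    apply hr
    apply Subtype.ext
    show (r : X) = a.base
    have hb : (a.lift r)⁻¹ • (r : X) = a.base := by
      rw [inv_smul_eq_iff, a.lift_smul]
    have hn0 : (n : K)⁻¹ • a.base = a.base := (n⁻¹).2
    rw [mul_smul, mul_smul, ← inv_smul_eq_iff, hb, ← inv_smul_eq_iff, hn0, eq_inv_smul_iff,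
      a.lift_smul] at h
    exact h
  · simp

end OrbitRep

/-- The matrices of a group representation on an invariant subspace, in a basis. -/
noncomputable def restrictMatrix {H W : Type*} [Group H] [AddCommGroup W] [Module ℂ W]
    [FiniteDimensional ℂ W] (τ : H →* Module.End ℂ W) (S : Submodule ℂ W)
    (hS : ∀ h, ∀ v ∈ S, τ h v ∈ S) :
    H →* Matrix (Fin (Module.finrank ℂ S)) (Fin (Module.finrank ℂ S)) ℂ where
  toFun h := LinearMap.toMatrix (Module.finBasis ℂ S) (Module.finBasis ℂ S)
    ((τ h).restrict (hS h))
  map_one' := by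
    rw [← LinearMap.toMatrix_one (Module.finBasis ℂ S)]
    congr 1
    ext v
    simp
  map_mul' h k := by
    rw [← LinearMap.toMatrix_mul]
    congr 1
    ext v
    simp

/-- The inclusion of an invariant subspace in coordinates. -/
noncomputable def coordIncl {W : Type*} [AddCommGroup W] [Module ℂ W]
    [FiniteDimensional ℂ W] (S : Submodule ℂ W) :
    (Fin (Module.finrank ℂ S) → ℂ) →ₗ[ℂ] W :=
  S.subtype ∘ₗ (Module.finBasis ℂ S).equivFun.symm.toLinearMap

section Coord

variable {H W : Type*} [Group H] [AddCommGroup W] [Module ℂ W] [FiniteDimensional ℂ W]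

theorem coordIncl_injective (S : Submodule ℂ W) : Function.Injective (coordIncl S) :=
  S.injective_subtype.comp (LinearEquiv.injective _)

theorem coordIncl_mem (S : Submodule ℂ W) (v) : coordIncl S v ∈ S :=
  Subtype.prop _

theorem exists_coordIncl (S : Submodule ℂ W) {w : W} (hw : w ∈ S) : ∃ v, coordIncl S v = w :=
  ⟨(Module.finBasis ℂ S).equivFun ⟨w, hw⟩, by simp [coordIncl]⟩

theorem coordIncl_restrictMatrix (τ : H →* Module.End ℂ W) (S : Submodule ℂ W)
    (hS : ∀ h, ∀ v ∈ S, τ h v ∈ S) (h : H) (v) :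
    τ h (coordIncl S v) = coordIncl S ((restrictMatrix τ S hS h).mulVec v) := by
  have h1 := LinearMap.toMatrix_mulVec_repr (Module.finBasis ℂ S) (Module.finBasis ℂ S)
    ((τ h).restrict (hS h)) ((Module.finBasis ℂ S).equivFun.symm v)
  have h2 : ((Module.finBasis ℂ S).repr ((Module.finBasis ℂ S).equivFun.symm v) : _ → ℂ) = v :=
    (Module.finBasis ℂ S).equivFun.apply_symm_apply v
  rw [h2] at h1
  show _ = S.subtype ((Module.finBasis ℂ S).equivFun.symm (Matrix.mulVec (LinearMap.toMatrix _ _ _) v))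
  rw [h1]
  have h3 := (Module.finBasis ℂ S).equivFun.symm_apply_apply
    (((τ h).restrict (hS h)) ((Module.finBasis ℂ S).equivFun.symm v))
  rw [Module.Basis.equivFun_apply] at h3
  rw [h3]
  rfl

end Coord

/-! ### Completeness of the projectors on finite-dimensional modules. -/

namespace OrbitRep

variable {X K : Type*} [Group K] [MulAction K X] [Fintype K] [Fintype X]
variable {W : Type*} [AddCommGroup W] [Module ℂ W]

/-- A lift of the orbit map, normalised at the base point. -/
noncomputable def chooseLift (x : X) (r : MulAction.orbit K x) : K :=
  if (r : X) = x then 1 else r.2.choose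

theorem chooseLift_smul (x : X) (r : MulAction.orbit K x) : chooseLift x r • x = r := by
  unfold chooseLift
  split_ifs with h
  · rw [one_smul, h]
  · exact r.2.choose_spec

/-- The representation of an isotropy group on an invariant subspace as orbit data. -/
noncomputable def ofInvariant [FiniteDimensional ℂ W] (x : X)
    (τ : MulAction.stabilizer K x →* Module.End ℂ W)
    (S : Submodule ℂ W) (hS : ∀ h, ∀ v ∈ S, τ h v ∈ S) : OrbitRep X K where
  base := x
  lift := chooseLift x
  lift_smul := chooseLift_smul x
  lift_base := if_pos rfl
  dim := Module.finrank ℂ S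
  rep := restrictMatrix τ S hS

/-- Subrepresentations in coordinates map injectively to invariant subspaces of `S`, so minimality
of `S` leaves only the two trivial ones. -/
theorem ofInvariant_isIrrep [FiniteDimensional ℂ W] (x : X)
    (τ : MulAction.stabilizer K x →* Module.End ℂ W)
    (S : Submodule ℂ W) (hS : ∀ h, ∀ v ∈ S, τ h v ∈ S) (hne : S ≠ ⊥)
    (hmin : ∀ T ≤ S, T ≠ ⊥ → (∀ h, ∀ v ∈ T, τ h v ∈ T) → T = S) :
    (ofInvariant x τ S hS).IsIrrep := by
  unfold IsIrrep
  have key : ∀ T : Subrepresentation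
      (((Matrix.toLinAlgEquiv' : Matrix (Fin (ofInvariant x τ S hS).dim) (Fin (ofInvariant x τ S hS).dim) ℂ ≃ₐ[ℂ] _) :
      Matrix (Fin (ofInvariant x τ S hS).dim) (Fin (ofInvariant x τ S hS).dim) ℂ →* _).comp (ofInvariant x τ S hS).rep :
      Representation ℂ (MulAction.stabilizer K (ofInvariant x τ S hS).base) (Fin (ofInvariant x τ S hS).dim → ℂ)),
      T.toSubmodule = ⊥ ∨ T.toSubmodule = ⊤ := by
    intro T
    by_cases hT : T.toSubmodule = ⊥
    · exact Or.inl hT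
    right
    have h1 : T.toSubmodule.map (coordIncl S) = S := by
      apply hmin
      · rintro _ ⟨v, -, rfl⟩
        exact coordIncl_mem S v
      · intro h
        apply hT
        rw [eq_bot_iff]
        intro v hv
        have h2 := Submodule.mem_map_of_mem (f := coordIncl S) hv
        rw [h, Submodule.mem_bot] at h2
        exact coordIncl_injective S (h2.trans (map_zero _).symm)
      · rintro h _ ⟨v, hv, rfl⟩
        rw [coordIncl_restrictMatrix τ S hS]
        exact Submodule.mem_map_of_mem (T.apply_mem_toSubmodule h hv)
    rw [eq_top_iff]
    intro v _
    have h2 : coordIncl S v ∈ T.toSubmodule.map (coordIncl S) := by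
      rw [h1]
      exact coordIncl_mem S v
    obtain ⟨u, hu, huv⟩ := h2
    rwa [← coordIncl_injective S huv]
  refine @IsSimpleOrder.mk _ _ _ ⟨⊥, ⊤, ?_⟩ ?_
  · intro h
    obtain ⟨w, hw, hw0⟩ := (Submodule.ne_bot_iff S).1 hne
    obtain ⟨v, rfl⟩ := exists_coordIncl S hw
    have h2 := congrArg Subrepresentation.toSubmodule h
    have h3 : v ∈ (⊥ : Submodule ℂ (Fin (Module.finrank ℂ S) → ℂ)) := by
      have : (⊥ : Submodule ℂ (Fin (Module.finrank ℂ S) → ℂ)) = ⊤ := h2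
      rw [this]
      trivial
    rw [Submodule.mem_bot] at h3
    exact hw0 (by rw [h3, map_zero])
  · intro T
    rcases key T with h | h
    · exact Or.inl (Subrepresentation.toSubmodule_injective h)
    · exact Or.inr (Subrepresentation.toSubmodule_injective h)

/-- Every nonzero invariant subspace contains a nonzero vector fixed by the projector of an
irrep. -/
theorem exists_fixed_vector [FiniteDimensional ℂ W] (A : Cross X K →ₐ[ℂ] Module.End ℂ W)
    (M : Submodule ℂ W) (hM : ∀ d, ∀ m ∈ M, A d m ∈ M) (hne : M ≠ ⊥) :
    ∃ b : OrbitRep X K, b.IsIrrep ∧ ∃ m ∈ M, m ≠ 0 ∧ A b.projector m = m := by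
  obtain ⟨m, hm, hm0⟩ := (Submodule.ne_bot_iff M).1 hne
  -- The δ_x sum to 1, so one of them does not kill `m`.
  obtain ⟨x, hx⟩ : ∃ x, A (Cross.basis x 1) m ≠ 0 := by
    by_contra! h
    apply hm0
    have h1 : A (∑ x, Cross.basis x 1) m = m := by
      rw [Cross.sum_basis_one, map_one, Module.End.one_apply]
    rw [← h1, map_sum, LinearMap.sum_apply]
    exact Finset.sum_eq_zero fun x _ => h x
  have hidem : ∀ w, A (Cross.basis x 1) (A (Cross.basis x 1) w) = A (Cross.basis x 1) w := by
    intro w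
    rw [← Module.End.mul_apply, ← map_mul, Cross.basis_mul_basis]
    simp
  set τ : MulAction.stabilizer K x →* Module.End ℂ W :=
    ((A : Cross X K →* Module.End ℂ W).comp Cross.ofGroup).comp
      (MulAction.stabilizer K x).subtype
  have hτ : ∀ h : MulAction.stabilizer K x, τ h = A (Cross.ofGroup (h : K)) := fun _ => rfl
  have hcomm : ∀ (h : MulAction.stabilizer K x) w,
      A (Cross.basis x 1) (τ h w) = τ h (A (Cross.basis x 1) w) := by
    intro h w
    have hh : (h : K) • x = x := h.2
    rw [hτ, ← Module.End.mul_apply, ← Module.End.mul_apply, ← map_mul, ← map_mul]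
    congr 2
    rw [← Cross.sum_basis, Finset.mul_sum, Finset.sum_mul]
    simp only [Cross.basis_mul_basis, one_smul, one_mul, mul_one, hh]
    simp
  -- A minimal nonzero subspace of M ∩ δ_x W stable under the isotropy group of `x`; it exists by
  -- finite dimension and carries the representation ρ of the required irrep.
  obtain ⟨S, ⟨hS1, hS2, hS3⟩, hSmin⟩ := WellFounded.has_min
    (wellFounded_lt (α := Submodule ℂ W))
    {S | S ≠ ⊥ ∧ (∀ w ∈ S, w ∈ M ∧ A (Cross.basis x 1) w = w) ∧ ∀ h, ∀ v ∈ S, τ h v ∈ S}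
    ⟨M ⊓ LinearMap.eqLocus (A (Cross.basis x 1)) LinearMap.id, by
      refine ⟨?_, fun w hw => hw, fun h v hv => ⟨hM _ _ hv.1, ?_⟩⟩
      · rw [Submodule.ne_bot_iff]
        exact ⟨_, ⟨hM _ _ hm, hidem m⟩, hx⟩
      · show A (Cross.basis x 1) (τ h v) = τ h v
        rw [hcomm]
        exact congrArg _ hv.2⟩
  set b := ofInvariant x τ S hS3
  have hb : b.IsIrrep := by
    refine ofInvariant_isIrrep x τ S hS3 hS1 fun T hT hT0 hTτ => ?_
    by_contra hTS
    exact hSmin T ⟨hT0, fun w hw => hS2 w (hT hw), hTτ⟩ (lt_of_le_of_ne hT hTS)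
  obtain ⟨w, hw, hw0⟩ := (Submodule.ne_bot_iff S).1 hS1
  obtain ⟨v, rfl⟩ := exists_coordIncl S hw
  refine ⟨b, hb, coordIncl S v, (hS2 _ hw).1, hw0, ?_⟩
  exact b.apply_projector_of_isotypic hb A (coordIncl S)
    (fun u => (hS2 _ (coordIncl_mem S u)).2)
    (fun n u => coordIncl_restrictMatrix τ S hS3 n u) v

/-- Nonzero pairwise orthogonal idempotents are linearly independent, and the algebra is
finite-dimensional. This makes the `finsum` over types a genuine sum. -/
theorem finite_projectors : {e : Cross X K | ∃ b : OrbitRep X K, b.IsIrrep ∧ b.projector = e}.Finite := by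
  apply LinearIndependent.setFinite (R := ℂ)
  rw [linearIndependent_iff']
  rintro s g hg ⟨e, b, hb, rfl⟩ he
  have h1 := congrArg (fun z => z * b.projector) hg
  simp only [Finset.sum_mul, zero_mul] at h1
  rw [Finset.sum_eq_single_of_mem _ he, smul_mul_assoc, b.projector_mul_self hb] at h1
  · exact (smul_eq_zero.1 h1).resolve_right (b.projector_ne_zero hb)
  · rintro ⟨_, c, hc, rfl⟩ _ hcb
    rw [smul_mul_assoc, c.projector_orthogonal b hc hb fun h => hcb (Subtype.ext h), smul_zero]

/-- The projectors acting nontrivially on a finite-dimensional module sum to the identity. -/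
theorem apply_finsum_projectors [FiniteDimensional ℂ W] (A : Cross X K →ₐ[ℂ] Module.End ℂ W) :
    A (∑ᶠ e ∈ {e : Cross X K | ∃ b : OrbitRep X K, b.IsIrrep ∧ A b.projector ≠ 0 ∧
      b.projector = e}, e) = 1 := by
  have hfin : {e : Cross X K | ∃ b : OrbitRep X K, b.IsIrrep ∧ A b.projector ≠ 0 ∧
      b.projector = e}.Finite :=
    finite_projectors.subset fun e ⟨b, hb, _, h⟩ => ⟨b, hb, h⟩
  rw [finsum_mem_eq_finite_toFinset_sum _ hfin]
  set E := ∑ e ∈ hfin.toFinset, e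
  have hE : ∀ d, d * E = E * d := by
    intro d
    rw [Finset.mul_sum, Finset.sum_mul]
    refine Finset.sum_congr rfl fun e he => ?_
    obtain ⟨b, -, -, rfl⟩ := hfin.mem_toFinset.1 he
    exact b.projector_comm d
  have hEb : ∀ b : OrbitRep X K, b.IsIrrep → A b.projector ≠ 0 →
      E * b.projector = b.projector := by
    intro b hb h0
    rw [Finset.sum_mul, Finset.sum_eq_single_of_mem b.projector
      (hfin.mem_toFinset.2 ⟨b, hb, h0, rfl⟩), b.projector_mul_self hb]
    intro e he heb
    obtain ⟨c, hc, -, rfl⟩ := hfin.mem_toFinset.1 he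
    exact c.projector_orthogonal b hc hb heb
  have hEE : E * E = E := by
    conv_lhs => rhs; rw [show E = ∑ e ∈ hfin.toFinset, e from rfl]
    rw [Finset.mul_sum]
    refine Finset.sum_congr rfl fun e he => ?_
    obtain ⟨b, hb, h0, rfl⟩ := hfin.mem_toFinset.1 he
    exact hEb b hb h0
  -- As `E` is central its kernel is a submodule. If nonzero, it contains a nonzero m with P_b m =
  -- m; then P_b is one of the summands of `E`, and E m = E P_b m = P_b m = m contradicts E m = 0.
  have hker : LinearMap.ker (A E) = ⊥ := by
    by_contra hne
    obtain ⟨b, hb, m, hm, hm0, hbm⟩ := exists_fixed_vector A (LinearMap.ker (A E)) (by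
      intro d m hm
      rw [LinearMap.mem_ker] at hm ⊢
      rw [← Module.End.mul_apply, ← map_mul, ← hE, map_mul, Module.End.mul_apply, hm,
        map_zero]) hne
    have h0 : A b.projector ≠ 0 := by
      intro h
      rw [h] at hbm
      exact hm0 hbm.symm
    rw [LinearMap.mem_ker, ← hbm, ← Module.End.mul_apply, ← map_mul, hEb b hb h0, hbm] at hm
    exact hm0 hm
  -- An injective idempotent is the identity.
  refine LinearMap.ext fun w => ?_
  apply LinearMap.ker_eq_bot.1 hker
  rw [← Module.End.mul_apply, ← map_mul, hEE]
  rfl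

end OrbitRep

end QDouble

/-! ### Restriction along the inclusion of Ξ(R,K), and the antipode of projectors. -/

namespace QDouble

variable {G : Type*} [Group G] [Fintype G]

section Restriction

variable {K : Subgroup G} (R : Transversal K) (b : OrbitRep R K) (a : OrbitRep (Flux G) G)

/-- The Hom space consists of the intertwiners into W_a pulled back along `incl`, so the averaging
criterion applies to the composite action. -/
theorem multiplicity_eq_zero_iff (hb : b.IsIrrep) :
    multiplicity R b a = 0 ↔ a.action (incl R b.projector) = 0 := by
  have h1 : multiplicity R b a = 0 ↔ restrictionHom R b a = ⊥ := Submodule.finrank_eq_zero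
  rw [h1]
  have h2 := b.apply_projector_eq_zero_iff hb (a.action.comp (incl R))
  refine Iff.trans ?_ h2.symm
  rw [Submodule.eq_bot_iff]
  rfl

theorem incl_projector_mul_projector_eq_zero_iff (hb : b.IsIrrep) (ha : a.IsIrrep) :
    incl R b.projector * a.projector = 0 ↔ multiplicity R b a = 0 := by
  rw [multiplicity_eq_zero_iff R b a hb]
  refine ⟨fun h => ?_, a.mul_projector_eq_zero⟩
  have := congrArg a.action h
  rwa [map_mul, a.action_projector ha, mul_one, map_zero] at this

/-- Types of nonzero multiplicity are those whose projectors act nontrivially on W_a. Their sum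
therefore acts there as 1, and multiplication by P_a sees only the action on W_a. -/
theorem incl_boundaryProjection_mul_projector :
    incl R (boundaryProjection R a) * a.projector = a.projector := by
  have h1 := OrbitRep.apply_finsum_projectors (a.action.comp (incl R))
  have h2 : {e : Xi R | ∃ b : OrbitRep R K, b.IsIrrep ∧ multiplicity R b a ≠ 0 ∧
      b.projector = e} = {e : Xi R | ∃ b : OrbitRep R K, b.IsIrrep ∧
        (a.action.comp (incl R)) b.projector ≠ 0 ∧ b.projector = e} := by
    ext e
    constructor
    · rintro ⟨b, hb, h, he⟩
      exact ⟨b, hb, fun h' => h ((multiplicity_eq_zero_iff R b a hb).2 h'), he⟩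
    · rintro ⟨b, hb, h, he⟩
      exact ⟨b, hb, fun h' => h ((multiplicity_eq_zero_iff R b a hb).1 h'), he⟩
  rw [← h2] at h1
  have h3 := a.mul_projector_congr (d := incl R (boundaryProjection R a)) (e := 1) (by
    rw [map_one]
    exact h1)
  rwa [one_mul] at h3

end Restriction

theorem antipode_basis_of_fixed {c : Flux G} {h : G} (hc : h • c = c) :
    antipode (Cross.basis c h) = Cross.basis c⁻¹ h⁻¹ := by
  have h1 := antipode_basis c.val h
  have h2 : (⟨h⁻¹ * c.val⁻¹ * h⟩ : Flux G) = c⁻¹ := by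
    have h3 : h⁻¹ • c⁻¹ = c⁻¹ := by
      rw [Flux.smul_inv, inv_smul_eq_iff.2 hc.symm]
    have h4 := congrArg Flux.val h3
    rw [Flux.smul_val, inv_inv] at h4
    exact Flux.ext h4
  rw [h2] at h1
  exact h1

/-- Inversion as a bijection from the isotropy group of `c₀` to that of `c₀⁻¹`. -/
def stabilizerInv (c : Flux G) : MulAction.stabilizer G c ≃ MulAction.stabilizer G c⁻¹ where
  toFun n := ⟨(n : G)⁻¹, Flux.mem_stabilizer_of_inv (by rw [Flux.inv_inv]; exact (n⁻¹).2)⟩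
  invFun n := ⟨(n : G)⁻¹, Flux.mem_stabilizer_of_inv (n⁻¹).2⟩
  left_inv n := Subtype.ext (inv_inv (n : G))
  right_inv n := Subtype.ext (inv_inv (n : G))

/-- Inversion as a bijection from the class of `c₀` to that of `c₀⁻¹`. -/
def orbitInv (c : Flux G) : MulAction.orbit G c ≃ MulAction.orbit G c⁻¹ where
  toFun r := ⟨(r : Flux G)⁻¹, Flux.inv_mem_orbit (by rw [Flux.inv_inv]; exact r.2)⟩
  invFun r := ⟨(r : Flux G)⁻¹, Flux.inv_mem_orbit r.2⟩
  left_inv r := Subtype.ext (Flux.inv_inv _)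
  right_inv r := Subtype.ext (Flux.inv_inv _)

/-- In every term of the projector the group element centralizes the flux, so the antipode merely
inverts both. Inverting orbit and isotropy elements matches the terms, a matrix and its transpose
having the same trace. -/
theorem antipode_projector (a : OrbitRep (Flux G) G) :
    antipode a.projector = (conjugate a).projector := by
  have hw : (conjugate a).weight = a.weight := by
    unfold OrbitRep.weight
    rw [Fintype.card_congr (stabilizerInv a.base)]
    rfl
  rw [OrbitRep.projector, OrbitRep.projector, map_smul, map_sum]
  show a.weight • _ = (conjugate a).weight • _
  rw [hw]
  congr 1
  refine Fintype.sum_equiv (orbitInv a.base) _ _ fun r => ?_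
  rw [map_sum]
  refine Fintype.sum_equiv (stabilizerInv a.base) _ _ fun n => ?_
  have hl : (conjugate a).lift (orbitInv a.base r) = a.lift r :=
    congrArg a.lift (Subtype.ext (Flux.inv_inv _))
  have hb : (a.lift r)⁻¹ • (r : Flux G) = a.base := by
    rw [inv_smul_eq_iff, a.lift_smul]
  have hn : (n : G) • a.base = a.base := n.2
  rw [map_smul, hl, antipode_basis_of_fixed (by
    rw [mul_smul, mul_smul, hb, hn, a.lift_smul])]
  congr 1
  · show _ = ((a.rep _).transpose).trace
    rw [Matrix.trace_transpose]
    congr 2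
    apply Subtype.ext
    show (n : G)⁻¹ = (((n : G)⁻¹)⁻¹)⁻¹
    rw [inv_inv]
  · congr 1
    simp [stabilizerInv, mul_assoc]

end QDouble

namespace QDouble

/-! ### Geometry of darts and sites -/

/-- The dart traversed in the opposite direction. -/
def Dart.rev (d : Dart) : Dart := ⟨d.tgt, d.dir + 2⟩

theorem Dart.rev_arrow (d : Dart) : d.rev.arrow = d.arrow := by
  obtain ⟨⟨x, y⟩, q⟩ := d
  fin_cases q <;> simp [Dart.rev, Dart.arrow, Dart.tgt, Dart.Forward, dirVec]

theorem Dart.rev_forward (d : Dart) : d.rev.Forward ↔ ¬ d.Forward := by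
  obtain ⟨⟨x, y⟩, q⟩ := d
  fin_cases q <;> simp [Dart.rev, Dart.Forward]

theorem arrow_faces (o : Chirality) (s : Site) :
    ((s.next o).arrow.leftFace = s.face ∧ (s.next o).arrow.rightFace = (s.step o .cross).face) ∨
    ((s.next o).arrow.rightFace = s.face ∧ (s.next o).arrow.leftFace = (s.step o .cross).face) := by
  obtain ⟨⟨x, y⟩, q⟩ := s
  cases o <;> fin_cases q <;>
    simp [Site.next, Site.step, Site.face, Dart.arrow, Dart.Forward, Dart.tgt, dirVec,
      Arrow.leftFace, Arrow.rightFace]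

theorem cross_face_ne (o : Chirality) (s : Site) : (s.step o .cross).face ≠ s.face := by
  obtain ⟨⟨x, y⟩, q⟩ := s
  cases o <;> fin_cases q <;> simp [Site.step, Site.face]

theorem walk_four (o : Chirality) (s : Site) :
    (((s.step o .walk).step o .walk).step o .walk).step o .walk = s := by
  obtain ⟨⟨x, y⟩, q⟩ := s
  cases o <;> fin_cases q <;> simp [Site.next, Site.step, Dart.tgt, dirVec]

/-- A face has only four sites, all met on one tour. This lets flatness at one site of a face pass
to the others. -/
theorem eq_walk_of_face_eq (o : Chirality) (s t : Site) (h : t.face = s.face) :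
    t = s ∨ t = s.step o .walk ∨ t = (s.step o .walk).step o .walk ∨
      t = ((s.step o .walk).step o .walk).step o .walk := by
  obtain ⟨⟨x, y⟩, q⟩ := s
  obtain ⟨⟨z, w⟩, r⟩ := t
  cases o <;> fin_cases q <;> fin_cases r <;>
    simp [Site.next, Site.step, Site.face, Dart.tgt, dirVec] at h ⊢ <;> omega

theorem walk_arrow_ne (o : Chirality) (s : Site) :
    ((s.step o .walk).next o).arrow ≠ (s.next o).arrow ∧
    (((s.step o .walk).step o .walk).next o).arrow ≠ (s.next o).arrow ∧
    ((((s.step o .walk).step o .walk).step o .walk).next o).arrow ≠ (s.next o).arrow := by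
  obtain ⟨⟨x, y⟩, q⟩ := s
  cases o <;> fin_cases q <;>
    simp [Site.next, Site.step, Dart.arrow, Dart.Forward, Dart.tgt, dirVec]

/-- Seen from the new face, the crossed arrow comes last in the tour and is traversed backwards.
This is why a crossing by h multiplies the holonomy there by h⁻¹ on the right. -/
theorem cross_last_next (o : Chirality) (s : Site) :
    ((((s.step o .cross).step o .walk).step o .walk).step o .walk).next o = (s.next o).rev := by
  obtain ⟨⟨x, y⟩, q⟩ := s
  cases o <;> fin_cases q <;>
    simp [Site.next, Site.step, Dart.rev, Dart.tgt, dirVec]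

theorem mirrored_next (s : Site) :
    s.next .mirrored = ((((s.step .standard .walk).step .standard .walk).step .standard
      .walk).next .standard).rev ∧
    (s.step .mirrored .walk).next .mirrored =
      (((s.step .standard .walk).step .standard .walk).next .standard).rev ∧
    ((s.step .mirrored .walk).step .mirrored .walk).next .mirrored =
      ((s.step .standard .walk).next .standard).rev ∧
    (((s.step .mirrored .walk).step .mirrored .walk).step .mirrored .walk).next .mirrored =
      (s.next .standard).rev := by
  obtain ⟨⟨x, y⟩, q⟩ := s
  fin_cases q <;> simp [Site.next, Site.step, Dart.rev, Dart.tgt, dirVec]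

variable {G : Type*} [Group G] {P : Set (ℤ × ℤ)}

/-! ### Values of darts and holonomies under local moves -/

theorem value_rev (σ : LatticeArrow P → G) (d : Dart) : value σ d.rev = (value σ d)⁻¹ := by
  by_cases h : d.arrow.leftFace ∈ P ∨ d.arrow.rightFace ∈ P
  · have h' : d.rev.arrow.leftFace ∈ P ∨ d.rev.arrow.rightFace ∈ P := by rwa [d.rev_arrow]
    have e : (⟨d.rev.arrow, h'⟩ : LatticeArrow P) = ⟨d.arrow, h⟩ := Subtype.ext d.rev_arrow
    by_cases hf : d.Forward
    · have hf' : ¬ d.rev.Forward := fun h0 => d.rev_forward.1 h0 hf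
      simp only [value, dif_pos h, dif_pos h', if_pos hf, if_neg hf', e]
    · have hf' : d.rev.Forward := d.rev_forward.2 hf
      simp only [value, dif_pos h, dif_pos h', if_neg hf, if_pos hf', e, inv_inv]
  · have h' : ¬ (d.rev.arrow.leftFace ∈ P ∨ d.rev.arrow.rightFace ∈ P) := by rwa [d.rev_arrow]
    simp only [value, dif_neg h, dif_neg h', inv_one]

theorem value_crossMove_of_ne {d e : Dart} (hde : d.arrow ≠ e.arrow) (h : G)
    (σ : LatticeArrow P → G) : value (crossMove e h σ) d = value σ d := by
  simp only [value, crossMove, if_neg hde]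

theorem value_crossMove_self {d : Dart} (hd : d.arrow.leftFace ∈ P ∨ d.arrow.rightFace ∈ P)
    (h : G) (σ : LatticeArrow P → G) : value (crossMove d h σ) d = h * value σ d := by
  by_cases hf : d.Forward <;> simp [value, crossMove, hd, hf]

theorem crossMove_mul (d : Dart) (h k : G) (σ : LatticeArrow P → G) :
    crossMove d h (crossMove d k σ) = crossMove d (h * k) σ := by
  funext e
  by_cases h1 : e.1 = d.arrow <;> by_cases h2 : d.Forward <;> simp [crossMove, h1, h2, mul_assoc]

theorem crossMove_one (d : Dart) (σ : LatticeArrow P → G) : crossMove d 1 σ = σ := by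
  funext e
  simp [crossMove]

/-- A dual triangle acts on the end of the arrow at its own vertex. A move at that vertex conjugates
its label, while a move at the opposite end multiplies from the other side and commutes with it. -/
theorem crossMove_vertexMove (v : ℤ × ℤ) (k : G) (d : Dart) (h : G) (σ : LatticeArrow P → G) :
    crossMove d ((if d.src = v then k else 1) * h * (if d.src = v then k else 1)⁻¹)
      (vertexMove v k σ) = vertexMove v k (crossMove d h σ) := by
  funext e
  by_cases he : e.1 = d.arrow
  · by_cases hf : d.Forward
    · have ht : e.1.tail = d.src := by rw [he]; simp [Dart.arrow, hf]
      by_cases hv : d.src = v <;> simp [crossMove, vertexMove, he, hf, hv, ← ht, mul_assoc] <;>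
        simp [← he, ht, hv]
    · have ht : e.1.head = d.src := by
        rw [he]
        obtain ⟨⟨x, y⟩, q⟩ := d
        fin_cases q <;> simp_all [Dart.arrow, Arrow.head, Dart.tgt, dirVec, Dart.Forward]
      by_cases hv : d.src = v <;> simp [crossMove, vertexMove, he, hf, hv, ← ht, mul_assoc] <;>
        simp [← he, ht, hv]
  · simp [crossMove, vertexMove, he]

theorem holonomy_walk (o : Chirality) (s : Site) (σ : LatticeArrow P → G) :
    holonomy o (s.step o .walk) σ =
      (value σ (s.next o))⁻¹ * holonomy o s σ * value σ (s.next o) := by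
  simp only [holonomy, walk_four]
  group

theorem holonomy_mirrored (s : Site) (σ : LatticeArrow P → G) :
    holonomy .mirrored s σ = (holonomy .standard s σ)⁻¹ := by
  obtain ⟨h1, h2, h3, h4⟩ := mirrored_next s
  simp only [holonomy, h1, h2, h3, h4, value_rev]
  group

theorem holonomy_eq_one_of_face_eq (o : Chirality) {s t : Site} (h : t.face = s.face)
    {σ : LatticeArrow P → G} (hs : holonomy o s σ = 1) : holonomy o t σ = 1 := by
  have h1 : ∀ s' : Site, holonomy o s' σ = 1 → holonomy o (s'.step o .walk) σ = 1 := by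
    intro s' hs'
    rw [holonomy_walk, hs']
    group
  rcases eq_walk_of_face_eq o s t h with rfl | rfl | rfl | rfl
  · exact hs
  · exact h1 _ hs
  · exact h1 _ (h1 _ hs)
  · exact h1 _ (h1 _ (h1 _ hs))

theorem face_of_arrow_eq (o : Chirality) {s t : Site}
    (h : (t.next o).arrow = (s.next o).arrow) :
    t.face = s.face ∨ t.face = (s.step o .cross).face := by
  rcases arrow_faces o t with ⟨h1, -⟩ | ⟨h1, -⟩ <;> rcases arrow_faces o s with ⟨h2, h3⟩ | ⟨h2, h3⟩ <;>
    rw [h] at h1 <;> simp only [← h1, h2, h3, true_or, or_true]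

theorem holonomy_crossMove_of_ne (o : Chirality) {s t : Site} (h1 : t.face ≠ s.face)
    (h2 : t.face ≠ (s.step o .cross).face) (h : G) (σ : LatticeArrow P → G) :
    holonomy o t (crossMove (s.next o) h σ) = holonomy o t σ := by
  have key : ∀ t' : Site, t'.face = t.face →
      value (crossMove (s.next o) h σ) (t'.next o) = value σ (t'.next o) := by
    intro t' ht'
    apply value_crossMove_of_ne
    intro he
    rcases face_of_arrow_eq o he with h3 | h3
    · exact h1 (ht'.symm.trans h3)
    · exact h2 (ht'.symm.trans h3)
  have f1 := step_walk_face o t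
  have f2 := (step_walk_face o (t.step o .walk)).trans f1
  have f3 := (step_walk_face o ((t.step o .walk).step o .walk)).trans f2
  simp only [holonomy, key t rfl, key _ f1, key _ f2, key _ f3]

theorem holonomy_crossMove (o : Chirality) {s : Site}
    (hs : s.face ∈ P ∨ (s.step o .cross).face ∈ P) (h : G) (σ : LatticeArrow P → G) :
    holonomy o s (crossMove (s.next o) h σ) = h * holonomy o s σ := by
  obtain ⟨h1, h2, h3⟩ := walk_arrow_ne o s
  simp only [holonomy, value_crossMove_of_ne h1, value_crossMove_of_ne h2,
    value_crossMove_of_ne h3, value_crossMove_self (next_arrow_mem o s hs), mul_assoc]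

theorem holonomy_cross_crossMove (o : Chirality) {s : Site}
    (hs : s.face ∈ P ∨ (s.step o .cross).face ∈ P) (h : G) (σ : LatticeArrow P → G) :
    holonomy o (s.step o .cross) (crossMove (s.next o) h σ) =
      holonomy o (s.step o .cross) σ * h⁻¹ := by
  have h0 := cross_last_next o s
  obtain ⟨h1, h2, h3⟩ := walk_arrow_ne o
    ((((s.step o .cross).step o .walk).step o .walk).step o .walk)
  rw [walk_four, h0, Dart.rev_arrow] at h1 h2 h3
  simp only [holonomy, h0, value_rev, value_crossMove_of_ne h1, value_crossMove_of_ne h2,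
    value_crossMove_of_ne h3, value_crossMove_self (next_arrow_mem o s hs), mul_inv_rev, mul_assoc]

/-! ### Ribbon operators in the group basis -/

/-- The product of the labels of the arrows traversed by a strip. -/
noncomputable def walkProd (o : Chirality) : Site → List Step → (LatticeArrow P → G) → G
  | _, [], _ => 1
  | s, .walk :: l, σ => value σ (s.next o) * walkProd o (s.step o .walk) l σ
  | s, .cross :: l, σ => walkProd o (s.step o .cross) l σ

/-- The configuration which a ribbon operator `F^{h,g}` moves to `σ`. -/
noncomputable def pull (o : Chirality) : Site → List Step → G → (LatticeArrow P → G) → LatticeArrow P → G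
  | _, [], _, σ => σ
  | s, .walk :: l, h, σ =>
      pull o (s.step o .walk) l ((value σ (s.next o))⁻¹ * h * value σ (s.next o)) σ
  | s, .cross :: l, h, σ => crossMove (s.next o) h⁻¹ (pull o (s.step o .cross) l h σ)

/-- No arrow is both crossed and traversed. -/
def Separated (o : Chirality) (s : Site) (l : List Step) : Prop :=
  ∀ τ ∈ triangles o s l, ∀ τ' ∈ triangles o s l,
    τ.2 = .cross → τ'.2 = .walk → (τ.1.next o).arrow ≠ (τ'.1.next o).arrow

theorem Separated.tail {o : Chirality} {s : Site} {x : Step} {l : List Step}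
    (h : Separated o s (x :: l)) : Separated o (s.step o x) l :=
  fun τ hτ τ' hτ' => h τ (List.mem_cons_of_mem _ hτ) τ' (List.mem_cons_of_mem _ hτ')

theorem value_pull (o : Chirality) (d : Dart) (l : List Step) : ∀ (s : Site) (h : G)
    (σ : LatticeArrow P → G),
    (∀ τ ∈ triangles o s l, τ.2 = .cross → (τ.1.next o).arrow ≠ d.arrow) →
      value (pull o s l h σ) d = value σ d := by
  induction l with
  | nil => intro s h σ _; rfl
  | cons x l ih =>
    intro s h σ hd
    have hd' := fun τ hτ => hd τ (List.mem_cons_of_mem _ hτ)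
    cases x with
    | walk => exact ih _ _ _ hd'
    | cross =>
      have h1 : (s.next o).arrow ≠ d.arrow := hd (s, .cross) List.mem_cons_self rfl
      exact (value_crossMove_of_ne h1.symm _ _).trans (ih _ _ _ hd')

/-- Pulling back alters only crossed arrows, so a traversed label is unaffected because the strip
does not overlap itself. -/
theorem value_pull_of_separated {o : Chirality} {s : Site} {l : List Step}
    (hl : Separated o s (.walk :: l)) (h : G) (σ : LatticeArrow P → G) :
    value (pull o (s.step o .walk) l h σ) (s.next o) = value σ (s.next o) :=
  value_pull o _ l _ _ _ fun τ hτ hc =>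
    hl τ (List.mem_cons_of_mem _ hτ) (s, .walk) List.mem_cons_self hc rfl

theorem walkProd_crossMove (o : Chirality) (d : Dart) (k : G) (l : List Step) : ∀ (s : Site)
    (σ : LatticeArrow P → G),
    (∀ τ ∈ triangles o s l, τ.2 = .walk → d.arrow ≠ (τ.1.next o).arrow) →
      walkProd o s l (crossMove d k σ) = walkProd o s l σ := by
  induction l with
  | nil => intro s σ _; rfl
  | cons x l ih =>
    intro s σ hd
    have hd' := fun τ hτ => hd τ (List.mem_cons_of_mem _ hτ)
    cases x with
    | walk =>
      have h1 : d.arrow ≠ (s.next o).arrow := hd (s, .walk) List.mem_cons_self rfl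
      simp only [walkProd, ih _ _ hd', value_crossMove_of_ne h1.symm]
    | cross => exact ih _ _ hd'

/-- Every configuration is pulled back from one with the same labels along the strip. -/
theorem exists_pull_eq (o : Chirality) (l : List Step) : ∀ (s : Site) (h : G)
    (τ : LatticeArrow P → G), Separated o s l →
      ∃ σ, pull o s l h σ = τ ∧ walkProd o s l σ = walkProd o s l τ := by
  induction l with
  | nil => exact fun s h τ _ => ⟨τ, rfl, rfl⟩
  | cons x l ih =>
    intro s h τ hl
    cases x with
    | walk =>
      obtain ⟨σ, h1, h2⟩ := ih (s.step o .walk)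
        ((value τ (s.next o))⁻¹ * h * value τ (s.next o)) τ hl.tail
      have h3 := value_pull_of_separated hl
        ((value τ (s.next o))⁻¹ * h * value τ (s.next o)) σ
      rw [h1] at h3
      refine ⟨σ, ?_, ?_⟩
      · rw [pull, ← h3, h1]
      · rw [walkProd, walkProd, h2, h3]
    | cross =>
      obtain ⟨σ, h1, h2⟩ := ih (s.step o .cross) h (crossMove (s.next o) h τ) hl.tail
      refine ⟨σ, ?_, ?_⟩
      · rw [pull, h1, crossMove_mul, inv_mul_cancel, crossMove_one]
      · rw [walkProd, walkProd, h2]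
        exact walkProd_crossMove o _ _ l _ _ fun τ' hτ' hw =>
          hl (s, .cross) List.mem_cons_self τ' (List.mem_cons_of_mem _ hτ') rfl hw

theorem walkProd_vertexMove (o : Chirality) (v : ℤ × ℤ) (k : G) (l : List Step) : ∀ (s : Site)
    (σ : LatticeArrow P → G), (∀ τ ∈ triangles o s l, (τ.1.step o τ.2).face ∈ P) →
      walkProd o s l (vertexMove v k σ) = (if s.vert = v then k else 1) * walkProd o s l σ *
        (if (lastSite o s l).vert = v then k else 1)⁻¹ := by
  induction l with
  | nil =>
    intro s σ _
    by_cases h : s.vert = v <;> simp [walkProd, lastSite, h]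
  | cons x l ih =>
    intro s σ hP
    have hP' := fun τ hτ => hP τ (List.mem_cons_of_mem _ hτ)
    have hf := hP (s, x) List.mem_cons_self
    cases x with
    | walk =>
      have hs : s.face ∈ P := by
        rw [← step_walk_face o s]
        exact hf
      rw [walkProd, walkProd, ih _ _ hP', value_vertexMove _ _ _ _ (next_arrow_mem o s (Or.inl hs)),
        next_src, next_tgt]
      show _ = _ * (if (lastSite o (s.step o .walk) l).vert = v then k else 1)⁻¹
      by_cases h1 : (s.step o .walk).vert = v <;> simp [h1, mul_assoc]
    | cross =>
      rw [walkProd, walkProd, ih _ _ hP']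
      have : (s.step o .cross).vert = s.vert := by cases o <;> rfl
      rw [this]
      rfl

/-- The label h lives at the current vertex and is transported along each traversed arrow. A vertex
move changes the transporting label so that h is conjugated exactly when it sits at that vertex. -/
theorem pull_vertexMove (o : Chirality) (v : ℤ × ℤ) (k : G) (l : List Step) : ∀ (s : Site) (h : G)
    (σ : LatticeArrow P → G), (∀ τ ∈ triangles o s l, (τ.1.step o τ.2).face ∈ P) →
      pull o s l ((if s.vert = v then k else 1) * h * (if s.vert = v then k else 1)⁻¹)
        (vertexMove v k σ) = vertexMove v k (pull o s l h σ) := by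
  induction l with
  | nil => intro s h σ _; rfl
  | cons x l ih =>
    intro s h σ hP
    have hP' := fun τ hτ => hP τ (List.mem_cons_of_mem _ hτ)
    have hf := hP (s, x) List.mem_cons_self
    cases x with
    | walk =>
      have hs : s.face ∈ P := by
        rw [← step_walk_face o s]
        exact hf
      rw [pull, pull, ← ih _ _ _ hP', value_vertexMove _ _ _ _ (next_arrow_mem o s (Or.inl hs)),
        next_src, next_tgt]
      congr 1
      by_cases h1 : (s.step o .walk).vert = v <;> by_cases h2 : s.vert = v <;>
        simp [h1, h2, mul_assoc]
    | cross =>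
      have hv : (s.step o .cross).vert = s.vert := by cases o <;> rfl
      have h1 := ih (s.step o .cross) h σ hP'
      rw [hv] at h1
      rw [pull, pull, h1, ← crossMove_vertexMove, next_src]
      congr 1
      group

/-- The holonomy at the end of a ribbon, for a configuration which is pulled back to a flat one. -/
theorem holonomy_lastSite (o : Chirality) (l : List Step) : ∀ (s : Site) (h : G)
    (σ : LatticeArrow P → G), Separated o s l →
    (∀ τ ∈ triangles o s l, (τ.1.step o τ.2).face ∈ P) →
    (s.face ∈ P → holonomy o s (pull o s l h σ) = h⁻¹) →
    (∀ t : Site, t.face ∈ P → t.face ≠ s.face → holonomy o t (pull o s l h σ) = 1) →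
    (lastSite o s l).face ∈ P →
    holonomy o (lastSite o s l) σ = (walkProd o s l σ)⁻¹ * h⁻¹ * walkProd o s l σ := by
  induction l with
  | nil =>
    intro s h σ _ _ h1 _ h3
    simpa [walkProd, lastSite, pull] using h1 h3
  | cons x l ih =>
    intro s h σ hl hP h1 h2 h3
    have hP' := fun τ hτ => hP τ (List.mem_cons_of_mem _ hτ)
    have hf := hP (s, x) List.mem_cons_self
    cases x with
    | walk =>
      have hs : s.face ∈ P := by
        rw [← step_walk_face o s]
        exact hf
      rw [pull] at h1 h2
      have hv := value_pull_of_separated hl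
        ((value σ (s.next o))⁻¹ * h * value σ (s.next o)) σ
      -- The face is unchanged, so the defect stays put and is only read from the next vertex,
      -- conjugated by the traversed label.
      rw [lastSite, ih _ ((value σ (s.next o))⁻¹ * h * value σ (s.next o)) σ hl.tail hP' ?_ ?_ h3,
        walkProd]
      · group
      · intro _
        rw [holonomy_walk, hv, h1 hs]
        group
      · intro t ht hts
        rw [step_walk_face] at hts
        exact h2 t ht hts
    | cross =>
      rw [pull] at h1 h2
      set τ := pull o (s.step o .cross) l h σ
      -- Undoing the crossing of the first arrow cancels the flux h⁻¹ on the old face and places it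
      -- on the new one, so the induction hypothesis sees a single defect, one face further along.
      have hτ : τ = crossMove (s.next o) h (crossMove (s.next o) h⁻¹ τ) := by
        rw [crossMove_mul, mul_inv_cancel, crossMove_one]
      have hf' : (s.step o .cross).face ∈ P := hf
      rw [lastSite, ih _ h σ hl.tail hP' ?_ ?_ h3, walkProd]
      · intro _
        show holonomy o _ τ = _
        rw [hτ, holonomy_cross_crossMove o (Or.inr hf'), h2 _ hf' (cross_face_ne o s), one_mul]
      · intro t ht hts
        show holonomy o _ τ = _
        rw [hτ]
        by_cases hts' : t.face = s.face
        · apply holonomy_eq_one_of_face_eq o hts'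
          rw [holonomy_crossMove o (Or.inr hf'), h1 (hts' ▸ ht), mul_inv_cancel]
        · rw [holonomy_crossMove_of_ne o hts' hts]
          exact h2 t ht hts'

/-- In each concatenation sum one f survives: the traversed label for a direct triangle, and e for a
dual one. For the former, the triangle tests the pulled-back configuration, whose label on that
arrow is the original one by separation. -/
theorem ribbonOpAux_apply [Fintype G] (o : Chirality) (l : List Step) : ∀ (s : Site) (h g : G)
    (ψ : State P G) (σ : LatticeArrow P → G), Separated o s l →
    ribbonOpAux o s l h g ψ σ = if walkProd o s l σ = g then ψ (pull o s l h σ) else 0 := by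
  induction l with
  | nil =>
    intro s h g ψ σ _
    by_cases hg : g = 1
    · simp [ribbonOpAux, walkProd, pull, hg]
    · simp [ribbonOpAux, walkProd, hg, Ne.symm hg]
  | cons x l ih =>
    intro s h g ψ σ hl
    rw [ribbonOpAux, LinearMap.sum_apply, Finset.sum_apply]
    simp only [Module.End.mul_apply, ih _ _ _ _ _ hl.tail]
    cases x with
    | walk =>
      have key : ∀ f, triangleOp (P := P) .walk (s.next o) h f ψ
          (pull o (s.step o .walk) l (f⁻¹ * h * f) σ) =
          if value σ (s.next o) = f then ψ (pull o (s.step o .walk) l (f⁻¹ * h * f) σ) else 0 := by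
        intro f
        rw [← value_pull_of_separated hl (f⁻¹ * h * f) σ]
        rfl
      simp only [key]
      rw [Finset.sum_eq_single (value σ (s.next o))]
      · simp only [walkProd, pull, if_true, eq_inv_mul_iff_mul_eq]
        congr
      · intro f _ hf
        simp [Ne.symm hf]
      · simp
    | cross =>
      rw [Finset.sum_eq_single 1]
      · simp only [triangleOp, if_true, walkProd, pull, inv_one, one_mul, mul_one]
        rfl
      · intro f _ hf
        simp [triangleOp, hf]
      · simp

end QDouble

namespace QDouble

variable {G : Type*} [Group G] [Fintype G] {K : Subgroup G} {P : Set (ℤ × ℤ)}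

/-! ### Vacuum states -/

theorem vertexAct_vac {vac : State P G} (hvac : IsVacuum K vac) {v : ℤ × ℤ}
    (hv : IsBulkVertex P v) (h : G) : vertexAct P v h vac = vac := by
  have h1 : vertexAct P v h * vertexProj P v = (vertexProj P v : Module.End ℂ (State P G)) := by
    rw [vertexProj, mul_smul_comm, Finset.mul_sum]
    congr 1
    refine Fintype.sum_equiv (Equiv.mulLeft h) _ _ fun k => ?_
    rw [Equiv.coe_mulLeft, map_mul]
  rw [← hvac.vertex v hv, ← Module.End.mul_apply, h1]

theorem vertexAct_vac_boundary {vac : State P G} (hvac : IsVacuum K vac) {o : Chirality}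
    (s : BoundarySite P o) (x : K) : vertexAct P s.vert (x : G) vac = vac := by
  have h1 : vertexAct P s.vert (x : G) * boundaryVertexProj K P s.vert =
      (boundaryVertexProj K P s.vert : Module.End ℂ (State P G)) := by
    rw [boundaryVertexProj, mul_smul_comm, Finset.mul_sum]
    congr 1
    refine Fintype.sum_equiv (Equiv.mulLeft x) _ _ fun k => ?_
    rw [Equiv.coe_mulLeft, Subgroup.coe_mul, map_mul]
  rw [← hvac.boundary_vertex o s, ← Module.End.mul_apply, h1]

theorem vac_vertexMove {vac : State P G} {v : ℤ × ℤ} {h : G} (hv : vertexAct P v h vac = vac)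
    (σ : LatticeArrow P → G) : vac (vertexMove v h⁻¹ σ) = vac σ :=
  congrFun hv σ

theorem holonomy_of_vac_ne_zero {vac : State P G} (hvac : IsVacuum K vac) (o : Chirality)
    {σ : LatticeArrow P → G} (hσ : vac σ ≠ 0) {s : Site} (hs : s.face ∈ P) :
    holonomy o s σ = 1 := by
  have h1 : holonomy .standard s σ = 1 := by
    by_contra h
    apply hσ
    rw [← hvac.face s hs]
    exact if_neg h
  cases o with
  | standard => exact h1
  | mirrored => rw [holonomy_mirrored, h1, inv_one]

theorem value_mem_of_vac_ne_zero {vac : State P G} (hvac : IsVacuum K vac) {o : Chirality}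
    (s : BoundarySite P o) {σ : LatticeArrow P → G} (hσ : vac σ ≠ 0) :
    value σ (s.toSite.next o) ∈ K := by
  by_contra h
  apply hσ
  rw [← hvac.boundary_face o s]
  exact if_neg h

theorem diag_apply_of_pos {p : (LatticeArrow P → G) → Prop} (ψ : State P G)
    {σ : LatticeArrow P → G} (h : p σ) : diag p ψ σ = ψ σ :=
  if_pos h

theorem diag_apply_of_neg {p : (LatticeArrow P → G) → Prop} (ψ : State P G)
    {σ : LatticeArrow P → G} (h : ¬ p σ) : diag p ψ σ = 0 :=
  if_neg h

theorem diag_apply_of_eq_zero (p : (LatticeArrow P → G) → Prop) (ψ : State P G)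
    {σ : LatticeArrow P → G} (h : ψ σ = 0) : diag p ψ σ = 0 :=
  (congrArg (fun z => ite (p σ) z 0) h).trans (ite_self _)

/-! ### Ribbon states -/

section Ribbon

variable {o : Chirality} {s₀ : BoundarySite P o} {s₁ : BulkSite P}
  (ξ : Ribbon P o s₀.toSite s₁.toSite)

theorem bulk_vert_ne (s₀ : BoundarySite P o) (s₁ : BulkSite P) : s₁.vert ≠ s₀.vert := by
  intro h
  have := s₁.isBulkVertex s₀.quad
  rw [h] at this
  exact s₀.face_notMem this

theorem Ribbon.lastSite_vert : (lastSite o s₀.toSite ξ.steps).vert = s₁.vert := by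
  rw [ξ.last_eq]

theorem ribbonOp_apply (h g : G) (ψ : State P G) (σ : LatticeArrow P → G) :
    ribbonOp ξ h g ψ σ =
      if walkProd o s₀.toSite ξ.steps σ = g then ψ (pull o s₀.toSite ξ.steps h σ) else 0 :=
  ribbonOpAux_apply o ξ.steps _ _ _ _ _ ξ.arrow_ne

/-- The end vertices differ, so the strip is nonempty. A direct first triangle would keep the outer
face, which is not in P. -/
theorem Ribbon.exists_steps_eq : ∃ l, ξ.steps = .cross :: l := by
  have h1 := ξ.last_eq
  have h2 := ξ.face_mem
  cases h : ξ.steps with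
  | nil =>
    rw [h] at h1
    have h3 : s₀.toSite = s₁.toSite := h1
    exact absurd (congrArg Site.vert h3).symm (bulk_vert_ne s₀ s₁)
  | cons x l =>
    cases x with
    | cross => exact ⟨l, rfl⟩
    | walk =>
      rw [h] at h2
      have h3 := h2 (s₀.toSite, .walk) List.mem_cons_self
      rw [step_walk_face] at h3
      exact absurd h3 s₀.face_notMem

theorem mem_triangles_face (l : List Step) : ∀ (s : Site), s.face ∈ P →
    (∀ τ ∈ triangles o s l, (τ.1.step o τ.2).face ∈ P) →
      ∀ τ ∈ triangles o s l, τ.1.face ∈ P := by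
  induction l with
  | nil => intro s _ _ τ hτ; simp [triangles] at hτ
  | cons x l ih =>
    intro s hs hP τ hτ
    rcases List.mem_cons.1 hτ with rfl | hτ
    · exact hs
    · exact ih _ (hP (s, x) List.mem_cons_self) (fun τ hτ => hP τ (List.mem_cons_of_mem _ hτ)) τ hτ

/-- A ribbon crosses the boundary arrow at its start exactly once. -/
theorem value_pull_boundary (h : G) (σ : LatticeArrow P → G) :
    value (pull o s₀.toSite ξ.steps h σ) (s₀.toSite.next o) =
      h⁻¹ * value σ (s₀.toSite.next o) := by
  obtain ⟨l, hl⟩ := ξ.exists_steps_eq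
  have hP := ξ.face_mem
  rw [hl] at hP ⊢
  have hP' := fun τ hτ => hP τ (List.mem_cons_of_mem _ hτ)
  rw [pull, value_crossMove_self (next_arrow_mem o _ (Or.inr s₀.face_mem)), value_pull]
  intro τ hτ hc he
  have h1 := mem_triangles_face l _ s₀.face_mem hP' τ hτ
  have h2 := hP' τ hτ
  rw [hc] at h2
  -- Crossing the boundary arrow again would make the outer face one of the two faces of a later
  -- triangle, and those all lie in P.
  rcases face_of_arrow_eq o he.symm with h3 | h3
  · exact s₀.face_notMem (h3 ▸ h1)
  · exact s₀.face_notMem (h3 ▸ h2)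

variable {vac : State P G}

/-- Covariance at the start vertex only, as the ribbon ends at another vertex; the move left over on
the vacuum is absorbed because x lies in K. -/
theorem vertexAct_start_ribbonOp (hvac : IsVacuum K vac) (x : K) (h g : G) :
    vertexAct P s₀.vert (x : G) (ribbonOp ξ h g vac) =
      ribbonOp ξ (x * h * (x : G)⁻¹) (x * g) vac := by
  funext σ
  show ribbonOp ξ h g vac (vertexMove s₀.vert (x : G)⁻¹ σ) = _
  have h1 := walkProd_vertexMove o s₀.vert (x : G)⁻¹ ξ.steps s₀.toSite σ ξ.face_mem
  have h2 := pull_vertexMove o s₀.vert (x : G)⁻¹ ξ.steps s₀.toSite (x * h * (x : G)⁻¹) σ ξ.face_mem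
  rw [if_pos rfl, ξ.lastSite_vert, if_neg (bulk_vert_ne s₀ s₁)] at h1
  have e : (x : G)⁻¹ * (x * h * (x : G)⁻¹) * ((x : G)⁻¹)⁻¹ = h := by group
  rw [if_pos rfl, e] at h2
  rw [ribbonOp_apply, ribbonOp_apply, h1, h2, vac_vertexMove (vertexAct_vac_boundary hvac s₀ x)]
  simp only [inv_one, mul_one, inv_mul_eq_iff_eq_mul]

theorem vertexAct_end_ribbonOp (hvac : IsVacuum K vac) (k h g : G) :
    vertexAct P s₁.vert k (ribbonOp ξ h g vac) = ribbonOp ξ h (g * k⁻¹) vac := by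
  funext σ
  show ribbonOp ξ h g vac (vertexMove s₁.vert k⁻¹ σ) = _
  have h1 := walkProd_vertexMove o s₁.vert k⁻¹ ξ.steps s₀.toSite σ ξ.face_mem
  have h2 := pull_vertexMove o s₁.vert k⁻¹ ξ.steps s₀.toSite h σ ξ.face_mem
  rw [if_neg (bulk_vert_ne s₀ s₁).symm, ξ.lastSite_vert, if_pos rfl] at h1
  rw [if_neg (bulk_vert_ne s₀ s₁).symm, inv_one, one_mul, mul_one] at h2
  rw [ribbonOp_apply, ribbonOp_apply, h1, h2, vac_vertexMove (vertexAct_vac hvac s₁.isBulkVertex k)]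
  simp only [one_mul, inv_inv, eq_mul_inv_iff_mul_eq]

theorem holonomy_end (hvac : IsVacuum K vac) {h : G} {σ : LatticeArrow P → G}
    (hσ : vac (pull o s₀.toSite ξ.steps h σ) ≠ 0) :
    holonomy o s₁.toSite σ = (walkProd o s₀.toSite ξ.steps σ)⁻¹ * h⁻¹ *
      walkProd o s₀.toSite ξ.steps σ := by
  have := holonomy_lastSite o ξ.steps s₀.toSite h σ ξ.arrow_ne ξ.face_mem
    -- The starting face lies outside the lattice, so no initial flux has to be prescribed.
    (fun h' => absurd h' s₀.face_notMem)
    (fun t ht _ => holonomy_of_vac_ne_zero hvac o hσ ht)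
    (by rw [ξ.last_eq]; exact s₁.isBulkVertex s₁.quad)
  rwa [ξ.last_eq] at this

/-- The linear map `D(G) → State`, `δ_c ⊗ g ↦ F_ξ^{c,g} ψ`. -/
noncomputable def ribbonState (ψ : State P G) : DG G →ₗ[ℂ] State P G where
  toFun d := ∑ c : Flux G, ∑ g : G, d.coeff c g • ribbonOp ξ c.val g ψ
  map_add' d e := by simp [add_smul, Finset.sum_add_distrib]
  map_smul' z d := by simp [mul_smul, Finset.smul_sum]

theorem ribbonState_basis (ψ : State P G) (c : Flux G) (g : G) :
    ribbonState ξ ψ (Cross.basis c g) = ribbonOp ξ c.val g ψ := by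
  show ∑ d : Flux G, ∑ k : G, (Cross.basis c g).coeff d k • ribbonOp ξ d.val k ψ = _
  rw [Finset.sum_eq_single c, Finset.sum_eq_single g]
  · simp [Cross.basis_coeff]
  · intro k _ hk
    simp [Cross.basis_coeff, hk]
  · simp
  · intro d _ hd
    simp [Cross.basis_coeff, hd]
  · simp

theorem ribbonState_projector (ψ : State P G) (a : OrbitRep (Flux G) G) :
    ribbonState ξ ψ a.projector = a.weight • ribbonTrace ξ a ψ := by
  rw [OrbitRep.projector, map_smul, map_sum]
  show a.weight • _ = _
  congr 1
  rw [ribbonTrace, LinearMap.sum_apply, Fintype.sum_prod_type]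
  refine Finset.sum_congr rfl fun r _ => ?_
  simp only [map_sum, map_smul, ribbonState_basis, quasiRibbonOp, LinearMap.sum_apply,
    LinearMap.smul_apply, Matrix.trace, Matrix.diag_apply, Finset.sum_smul]
  rw [Finset.sum_comm]

/-- Each coefficient is isolated by evaluating at one configuration, since the product along the
strip determines g and the flux at s₁ then determines c. -/
theorem ribbonState_injective (hvac : IsVacuum K vac) (hne : vac ≠ 0) :
    Function.Injective (ribbonState ξ vac) := by
  rw [← LinearMap.ker_eq_bot, LinearMap.ker_eq_bot']
  intro d hd
  ext c g
  rw [Cross.zero_coeff]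
  obtain ⟨τ₀, hτ₀⟩ := Function.ne_iff.1 hne
  set w := walkProd o s₀.toSite ξ.steps τ₀
  -- A move at the bulk end vertex multiplies the product along the strip on the right by any group
  -- element without changing the vacuum amplitude; w⁻¹g takes it from `w` to `g`.
  have hv := vac_vertexMove (vertexAct_vac hvac s₁.isBulkVertex (w⁻¹ * g)) τ₀
  set τ := vertexMove s₁.vert (w⁻¹ * g)⁻¹ τ₀
  have hw : walkProd o s₀.toSite ξ.steps τ = g := by
    have h1 := walkProd_vertexMove o s₁.vert (w⁻¹ * g)⁻¹ ξ.steps s₀.toSite τ₀ ξ.face_mem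
    rw [if_neg (bulk_vert_ne s₀ s₁).symm, ξ.lastSite_vert, if_pos rfl] at h1
    rw [h1]
    show 1 * w * _ = g
    group
  obtain ⟨σ, h1, h2⟩ := exists_pull_eq o ξ.steps s₀.toSite c.val τ ξ.arrow_ne
  rw [hw] at h2
  have hσ : vac (pull o s₀.toSite ξ.steps c.val σ) ≠ 0 := by
    rw [h1, hv]
    exact hτ₀
  have h3 : ∑ c' : Flux G, ∑ g' : G, d.coeff c' g' * ribbonOp ξ c'.val g' vac σ = 0 := by
    have := congrFun hd σ
    refine Eq.trans ?_ this
    show _ = (∑ c : Flux G, ∑ g : G, d.coeff c g • ribbonOp ξ c.val g vac) σ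
    simp only [Finset.sum_apply, Pi.smul_apply, smul_eq_mul]
  simp only [ribbonOp_apply, h2] at h3
  rw [Finset.sum_eq_single c, Finset.sum_eq_single g] at h3
  · rw [if_pos rfl] at h3
    exact (mul_eq_zero.1 h3).resolve_right hσ
  · intro g' _ hg'
    rw [if_neg hg'.symm, mul_zero]
  · simp
  · intro c' _ hc'
    refine Finset.sum_eq_zero fun g' _ => ?_
    -- Nonzero amplitudes for both `c` and `c'` would give two values of the same holonomy at s₁,
    -- conjugated by the same strip product.
    have h4 : vac (pull o s₀.toSite ξ.steps c'.val σ) = 0 := by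
      by_contra h5
      have h6 := holonomy_end ξ hvac h5
      rw [holonomy_end ξ hvac hσ] at h6
      apply hc'
      apply Flux.ext
      simpa using h6.symm
    rw [h4, ite_self, mul_zero]
  · simp

/-- The vertex action reproduces x(δ_c ⊗ g) = δ_{xcx⁻¹} ⊗ xg. On the support of F^{h,g}|vac⟩ the
boundary label is h times an element of K, so testing its coset against rK is testing h, which is
multiplication by i(δ_r). -/
theorem boundaryAct_ribbonState (R : Transversal K) (hvac : IsVacuum K vac) (b : Xi R)
    (d : DG G) :
    boundaryAct R s₀ b (ribbonState ξ vac d) = ribbonState ξ vac (incl R b * d) := by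
  have key : ∀ (r : R) (x : K) (c : Flux G) (g : G),
      boundaryAct R s₀ (Cross.basis r x) (ribbonState ξ vac (Cross.basis c g)) =
        ribbonState ξ vac (incl R (Cross.basis r x) * Cross.basis c g) := by
    intro r x c g
    have h1 : (Cross.ofGroup (x : G) : DG G) * Cross.basis c g =
        Cross.basis ((x : G) • c) (x * g) := by
      rw [← Cross.sum_basis, Finset.sum_mul]
      simp [Cross.basis_mul_basis]
    have h2 : ∀ (c : Flux G) (g : G), inclDelta R r * Cross.basis c g =
        if (c.val : G ⧸ K) = R.toCoset r then Cross.basis c g else 0 := by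
      intro c g
      ext d k
      rw [Cross.mul_coeff, Finset.sum_eq_single 1]
      · simp only [inclDelta_coeff, inv_one, one_smul, one_mul, true_and, Cross.basis_coeff]
        by_cases hd : d = c
        · subst hd
          split_ifs <;> simp_all [Cross.basis_coeff]
        · split_ifs <;> simp_all [Cross.basis_coeff]
      · intro l _ hl
        simp [inclDelta_coeff, hl]
      · simp
    have h3 : incl R (Cross.basis r x) = inclDelta R r * Cross.ofGroup (x : G) :=
      Cross.covariant_basis _ _ _ _ _ r x
    have h4 : boundaryAct R s₀ (Cross.basis r x) =
        diag (fun σ => ((value σ (s₀.toSite.next o) : G) : G ⧸ K) = R.toCoset r) *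
          vertexAct P s₀.vert (x : G) :=
      Cross.covariant_basis _ _ _ _ _ r x
    rw [h4, Module.End.mul_apply, ribbonState_basis, vertexAct_start_ribbonOp ξ hvac, h3,
      mul_assoc (inclDelta R r), h1, h2, Flux.smul_val]
    set h := (x : G) * c.val * (x : G)⁻¹
    have h5 : ∀ σ, ribbonOp ξ h (x * g) vac σ ≠ 0 →
        ((value σ (s₀.toSite.next o) : G) : G ⧸ K) = (h : G ⧸ K) := by
      intro σ hσ
      rw [ribbonOp_apply] at hσ
      have h6 := value_mem_of_vac_ne_zero hvac s₀ fun h0 => hσ (by rw [h0, ite_self])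
      rw [value_pull_boundary] at h6
      exact (QuotientGroup.eq.2 h6).symm
    funext σ
    by_cases h7 : (h : G ⧸ K) = R.toCoset r
    · rw [if_pos h7, ribbonState_basis]
      by_cases hσ : ribbonOp ξ h (x * g) vac σ = 0
      · exact (diag_apply_of_eq_zero _ _ hσ).trans hσ.symm
      · exact diag_apply_of_pos _ ((h5 σ hσ).trans h7)
    · rw [if_neg h7, map_zero]
      by_cases hσ : ribbonOp ξ h (x * g) vac σ = 0
      · exact diag_apply_of_eq_zero _ _ hσ
      · exact diag_apply_of_neg _ fun h8 => h7 ((h5 σ hσ).symm.trans h8)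
  have key' : ∀ (r : R) (x : K),
      boundaryAct R s₀ (Cross.basis r x) (ribbonState ξ vac d) =
        ribbonState ξ vac (incl R (Cross.basis r x) * d) := by
    intro r x
    rw [Cross.eq_sum_basis d]
    simp only [map_sum, map_smul, Finset.mul_sum, mul_smul_comm, key]
  rw [Cross.eq_sum_basis b]
  simp only [map_sum, map_smul, LinearMap.sum_apply, LinearMap.smul_apply, Finset.sum_mul,
    smul_mul_assoc, key']

/-- The antipode of δ_f ⊗ k acts at the end vertex by k⁻¹, turning g into gk. The flux at s₁ is then
(gk)⁻¹c⁻¹(gk), and the face factor requires it to be k⁻¹f⁻¹k, that is c = gfg⁻¹, the condition in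
the product of basis elements. -/
theorem bulkRightAct_ribbonState (hvac : IsVacuum K vac) (d e : DG G) :
    bulkRightAct o s₁ (ribbonState ξ vac d) e = ribbonState ξ vac (d * e) := by
  have key : ∀ (c : Flux G) (g : G) (f : Flux G) (k : G),
      bulkAct o s₁ (antipode (Cross.basis f k)) (ribbonState ξ vac (Cross.basis c g)) =
        ribbonState ξ vac (Cross.basis c g * Cross.basis f k) := by
    intro c g f k
    have h1 := antipode_basis f.val k
    have h4 : bulkAct o s₁ (Cross.basis ⟨k⁻¹ * f.val⁻¹ * k⟩ k⁻¹) =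
        diag (fun σ => holonomy o s₁.toSite σ = k⁻¹ * f.val⁻¹ * k) *
          vertexAct P s₁.vert k⁻¹ :=
      Cross.covariant_basis _ _ _ _ _ _ _
    have h1' : antipode (Cross.basis f k) = Cross.basis ⟨k⁻¹ * f.val⁻¹ * k⟩ k⁻¹ := h1
    rw [h1', h4, Module.End.mul_apply, ribbonState_basis, vertexAct_end_ribbonOp ξ hvac, inv_inv,
      Cross.basis_mul_basis]
    have h5 : ∀ σ, ribbonOp ξ c.val (g * k) vac σ ≠ 0 →
        (holonomy o s₁.toSite σ = k⁻¹ * f.val⁻¹ * k ↔ c = g • f) := by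
      intro σ hσ
      rw [ribbonOp_apply] at hσ
      have hw : walkProd o s₀.toSite ξ.steps σ = g * k := by
        by_contra h
        exact hσ (if_neg h)
      have h6 := holonomy_end ξ hvac fun h0 => hσ (by rw [h0, ite_self])
      rw [h6, hw]
      have h7 : (g * k)⁻¹ * c.val⁻¹ * (g * k) = k⁻¹ * (g⁻¹ * c.val * g)⁻¹ * k := by group
      rw [h7, mul_left_inj, mul_right_inj, inv_inj, Flux.ext_iff, Flux.smul_val]
      constructor
      · intro h
        rw [← h]
        group
      · intro h
        rw [h]
        group
    funext σ
    by_cases h7 : c = g • f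
    · rw [if_pos h7, ribbonState_basis]
      by_cases hσ : ribbonOp ξ c.val (g * k) vac σ = 0
      · exact (diag_apply_of_eq_zero _ _ hσ).trans hσ.symm
      · exact diag_apply_of_pos _ ((h5 σ hσ).2 h7)
    · rw [if_neg h7, map_zero]
      by_cases hσ : ribbonOp ξ c.val (g * k) vac σ = 0
      · exact diag_apply_of_eq_zero _ _ hσ
      · exact diag_apply_of_neg _ fun h8 => h7 ((h5 σ hσ).1 h8)
  have key' : ∀ (f : Flux G) (k : G),
      bulkAct o s₁ (antipode (Cross.basis f k)) (ribbonState ξ vac d) =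
        ribbonState ξ vac (d * Cross.basis f k) := by
    intro f k
    rw [Cross.eq_sum_basis d]
    simp only [map_sum, map_smul, Finset.sum_mul, smul_mul_assoc, key]
  rw [bulkRightAct, Cross.eq_sum_basis e]
  simp only [map_sum, map_smul, LinearMap.sum_apply, LinearMap.smul_apply, Finset.mul_sum,
    mul_smul_comm, key']

end Ribbon

end QDouble

theorem mainTheorem12 {G : Type*} [Group G] [Fintype G] (K : Subgroup G)
    (R : QDouble.Transversal K) (P : Set (ℤ × ℤ)) (o : QDouble.Chirality)
    (s₀ : QDouble.BoundarySite P o) (s₁ : QDouble.BulkSite P)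
    (ξ : QDouble.Ribbon P o s₀.toSite s₁.toSite)
    (vac : QDouble.State P G) (hvac : QDouble.IsVacuum K vac) (hne : vac ≠ 0)
    (a : QDouble.OrbitRep (QDouble.Flux G) G) (ha : a.IsIrrep) :
    (∀ b : QDouble.OrbitRep R K, b.IsIrrep →
      (QDouble.boundaryAct R s₀ b.projector (QDouble.ribbonTrace ξ a vac) = 0 ↔
        QDouble.multiplicity R b a = 0)) ∧
    QDouble.boundaryAct R s₀ (QDouble.boundaryProjection R a) (QDouble.ribbonTrace ξ a vac) =
      QDouble.ribbonTrace ξ a vac ∧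
    QDouble.bulkRightAct o s₁ (QDouble.ribbonTrace ξ a vac) a.projector =
      QDouble.ribbonTrace ξ a vac ∧
    QDouble.bulkAct o s₁ (QDouble.conjugate a).projector (QDouble.ribbonTrace ξ a vac) =
      QDouble.ribbonTrace ξ a vac := by
  have hw : QDouble.ribbonTrace ξ a vac =
      a.weight⁻¹ • QDouble.ribbonState ξ vac a.projector := by
    rw [QDouble.ribbonState_projector, inv_smul_smul₀ (a.weight_ne_zero ha)]
  have h3 : QDouble.bulkRightAct o s₁ (QDouble.ribbonTrace ξ a vac) a.projector =
      QDouble.ribbonTrace ξ a vac := by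
    have := QDouble.bulkRightAct_ribbonState ξ hvac a.projector a.projector
    rw [a.projector_mul_self ha] at this
    rw [QDouble.bulkRightAct] at this ⊢
    rw [hw, map_smul, this]
  refine ⟨fun b hb => ?_, ?_, h3, ?_⟩
  · rw [hw, map_smul, QDouble.boundaryAct_ribbonState ξ R hvac,
      smul_eq_zero_iff_right (inv_ne_zero (a.weight_ne_zero ha)),
      ← QDouble.incl_projector_mul_projector_eq_zero_iff R b a hb ha]
    exact map_eq_zero_iff _ (QDouble.ribbonState_injective ξ hvac hne)
  · rw [hw, map_smul, QDouble.boundaryAct_ribbonState ξ R hvac,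
      QDouble.incl_boundaryProjection_mul_projector]
  -- The right action is defined through the antipode, so this is the same identity as `h3`.
  · rw [← QDouble.antipode_projector]
    exact h3
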